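/- **Conventions.** Let $n\ge 1$ and $n<q\le p<\infty$. Let $\Omega,\widetilde\Omega\subset\mathbb R^n$ be domains (nonempty connected open sets). $L^1_p(\Omega)$ is the space of locally integrable weakly differentiable functions $f:\Omega\to\mathbb R$ with $\|f\mid L^1_p(\Omega)\|:=\|\nabla f\mid L_p(\Omega)\|<\infty$; we put $\|f\mid L^1_p(\Omega)\|=\infty$ if $f$ is not weakly differentiable. For a weakly differentiable mapping $\varphi$ let $D\varphi$ be its weak differential with operator norm $|D\varphi|$, let $J(x,\varphi)=\det D\varphi(x)$, and let $K_p(x)$ be the least $k\in[0,\infty]$ with $|D\varphi(x)|\le k\,|J(x,\varphi)|^{1/p}$ (with $K_p(x)=\infty$ if $J(x,\varphi)=0\neq D\varphi(x)$). A homeomorphism $\varphi:\Omega\to\widetilde\Omega$ is *weakly $(p,q)$-quasiconformal* if $\varphi\in W^1_{q,\mathrm{loc}}(\Omega)$, $D\varphi=0$ a.e. on $\{J(\cdot,\varphi)=0\}$, and $$K_{p,q}(\varphi;\Omega):=\|K_p\mid L_\kappa(\Omega)\|<\infty,\qquad \tfrac1\kappa=\tfrac1q-\tfrac1p\quad(\kappa=\infty\text{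 if }p=q).$$ For $q<p$ and open $A\subset\widetilde\Omega$ put $$\Phi(A)=\sup_f\left(\frac{\|f\circ\varphi\mid L^1_q(\Omega)\|}{\|f\mid L^1_p(A)\|}\right)^{\kappa},$$ the supremum being over all $f\in L^1_p(\widetilde\Omega)$ that are continuous with compact support in $A$ (with $0/0=0$). For $p=q$ the symbol $\Phi(A)^{\frac{p-q}{pq}}$ stands for $K_{p,p}(\varphi;\Omega)$. **Theorem.** There is a constant $c=c(n,p,q)>0$ such that for all such $\Omega,\widetilde\Omega$ and every weakly $(p,q)$-quasiconformal homeomorphism $\varphi:\Omega\to\widetilde\Omega$ the following hold. 1. If $y_1,y_2\in\widetilde\Omega$ and $|y_1-y_2|=r<\operatorname{dist}(y_1,\partial\widetilde\Omega)$ (where $\operatorname{dist}(y_1,\emptyset)=\infty$), then $\Phi(B(y_1,r))^{\frac{p-q}{pq}}<\infty$ and $$|y_1-y_2|^{\frac{p-n}{p}}\le c\,\Phi(B(y_1,r))^{\frac{p-q}{pq}}\,|\varphi^{-1}(y_1)-\varphi^{-1}(y_2)|^{\frac{q-n}{q}}.$$ 2. Let $\gamma=\frac{(q-n)p}{(p-n)q}$.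 Then $0<\gamma\le1$, and $\varphi$ is locally Hölder continuous with exponent $\gamma$: there is a constant $C$ with $|\varphi(x_1)-\varphi(x_2)|\le C|x_1-x_2|^\gamma$ for all $x_1,x_2\in\Omega$ such that $|\varphi(x_1)-\varphi(x_2)|<\operatorname{dist}(\varphi(x_1),\partial\widetilde\Omega)$; and for every compact $F\subset\Omega$ there is a constant $C_F$ with $|\varphi(x_1)-\varphi(x_2)|\le C_F|x_1-x_2|^\gamma$ for all $x_1,x_2\in F$. -/

import Mathlib

open MeasureTheory
open scoped ENNReal ContDiff

/-- `ℝⁿ` with its Euclidean norm. -/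
abbrev RSpace (n : ℕ) : Type := EuclideanSpace ℝ (Fin n)

/-- `D` is a weak (distributional) first derivative of `f` on the open set `Ω`: both are locally
integrable on `Ω`, and integration by parts holds against every smooth compactly supported test
function in every direction. For `F = ℝ`, `D x` is the functional `⟨∇f(x), ·⟩`; for `F = ℝⁿ`, it is
the operator of the formal Jacobi matrix. In both cases the norm of `D x` is the operator norm. -/
def IsWeakFDeriv {n : ℕ} {F : Type*} [NormedAddCommGroup F] [NormedSpace ℝ F]
    (Ω : Set (RSpace n)) (f : RSpace n → F) (D : RSpace n → RSpace n →L[ℝ] F) : Prop :=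
  LocallyIntegrableOn f Ω volume ∧ LocallyIntegrableOn D Ω volume ∧
    ∀ ψ : RSpace n → ℝ, ContDiff ℝ ∞ ψ → HasCompactSupport ψ → tsupport ψ ⊆ Ω →
      ∀ v : RSpace n,
        ∫ x in Ω, (fderiv ℝ ψ x v) • f x = -∫ x in Ω, ψ x • D x v

/-- The seminorm `‖f | L¹_p(Ω)‖ = ‖∇f | L_p(Ω)‖`. It is `∞` if `f` has no weak gradient on `Ω`;
otherwise the weak gradient is unique almost everywhere, and all terms of the infimum agree. -/
noncomputable def sobolevSeminorm {n : ℕ} (p : ℝ) (Ω : Set (RSpace n)) (f : RSpace n → ℝ) :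
    ℝ≥0∞ :=
  ⨅ (D : RSpace n → RSpace n →L[ℝ] ℝ) (_ : IsWeakFDeriv Ω f D),
    eLpNorm D (ENNReal.ofReal p) (volume.restrict Ω)

/-- The normalized `p`-dilatation of a linear map `T` (the differential at a point): the least
`k ∈ [0, ∞]` with `|T| ≤ k |det T|^{1/p}`. It is `∞` if `det T = 0` and `T ≠ 0`, and `0` if
`T = 0` (and `det T = 0`). -/
noncomputable def pDilatation {n : ℕ} (p : ℝ) (T : RSpace n →L[ℝ] RSpace n) : ℝ≥0∞ :=
  sInf {k : ℝ≥0∞ | ‖T‖ₑ ≤ k * ‖T.det‖ₑ ^ (1 / p)}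

/-- The exponent `κ` with `1/κ = 1/q - 1/p`; it is `∞` if `p = q`. -/
noncomputable def kappa (p q : ℝ) : ℝ≥0∞ := (ENNReal.ofReal (1 / q - 1 / p))⁻¹

/-- `K_{p,q}(φ;Ω) = ‖K_p | L_κ(Ω)‖`, where `K_p` is the `p`-dilatation of the weak differential
of `φ` (which is unique almost everywhere when it exists). -/
noncomputable def distortionNorm {n : ℕ} (p q : ℝ) (Ω : Set (RSpace n))
    (φ : RSpace n → RSpace n) : ℝ≥0∞ :=
  ⨅ (D : RSpace n → RSpace n →L[ℝ] RSpace n) (_ : IsWeakFDeriv Ω φ D),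
    eLpNorm (fun x => pDilatation p (D x)) (kappa p q) (volume.restrict Ω)

/-- The analytic conditions on a homeomorphism `φ` of `Ω` that make it weakly
`(p,q)`-quasiconformal: `φ ∈ W¹_{q,loc}(Ω)`, finite distortion (`Dφ = 0` almost everywhere on the
zero set of the Jacobian), and `K_p ∈ L_κ(Ω)`. -/
def IsWeakQuasiconformal {n : ℕ} (p q : ℝ) (Ω : Set (RSpace n))
    (φ : RSpace n → RSpace n) : Prop :=
  ∃ D : RSpace n → RSpace n →L[ℝ] RSpace n,
    IsWeakFDeriv Ω φ D ∧
    (∀ F : Set (RSpace n), F ⊆ Ω → IsCompact F →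
      MemLp φ (ENNReal.ofReal q) (volume.restrict F) ∧
      MemLp D (ENNReal.ofReal q) (volume.restrict F)) ∧
    (∀ᵐ x ∂(volume.restrict Ω), (D x).det = 0 → D x = 0) ∧
    eLpNorm (fun x => pDilatation p (D x)) (kappa p q) (volume.restrict Ω) < ⊤

/-- The set function
`Φ(A) = sup (‖f ∘ φ | L¹_q(Ω)‖ / ‖f | L¹_p(A)‖)^κ`, for `q < p` and `κ = pq/(p-q)`, where the
supremum is over all `f ∈ L¹_p(Ω')` that are continuous with compact support in `A ⊆ Ω'`.
If the denominator vanishes, then so does `f`, and the quotient is `0 / 0 = 0`. -/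
noncomputable def PhiSet {n : ℕ} (p q : ℝ) (Ω Ω' : Set (RSpace n)) (φ : RSpace n → RSpace n)
    (A : Set (RSpace n)) : ℝ≥0∞ :=
  ⨆ (f : RSpace n → ℝ) (_ : Continuous f ∧ HasCompactSupport f ∧ tsupport f ⊆ A ∧
      sobolevSeminorm p Ω' f < ⊤),
    (sobolevSeminorm q Ω (f ∘ φ) / sobolevSeminorm p A f) ^ (p * q / (p - q))

open scoped Classical in
/-- The factor `Φ(A)^{(p-q)/(pq)}`, which for `p = q` stands for `K_{p,p}(φ;Ω)`. -/
noncomputable def PhiFactor {n : ℕ} (p q : ℝ) (Ω Ω' : Set (RSpace n)) (φ : RSpace n → RSpace n)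
    (A : Set (RSpace n)) : ℝ≥0∞ :=
  if p = q then distortionNorm p p Ω φ else PhiSet p q Ω Ω' φ A ^ ((p - q) / (p * q))

/-!
The argument is potential-theoretic. With `r = |y₁ - y₂|`, take a smooth bump function `f` that is
`1` at `y₁`, vanishes off the ball `B(y₁, r / 2)`, and satisfies
`‖f | L¹_p‖ ≤ const * r ^ (n / p - 1)`. Its pullback `f ∘ φ` has compact support in `Ω`, takes the
values `1` and `0` at `φ⁻¹ y₁` and `φ⁻¹ y₂`, and by the definition of `Φ` has seminorm in `L¹_q`
at most `Φ(B(y₁, r)) ^ (1 / κ) * ‖f | L¹_p‖`. As `q > n`, Morrey's inequality bounds the difference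
`1` of these values by a constant times this seminorm times
`|φ⁻¹ y₁ - φ⁻¹ y₂| ^ (1 - n / q)`, which is the metric distortion inequality
(`exists_metric_distortion_const`).

The other half of the work is that `Φ` is finite, more precisely that
`Φ(A) ^ (1 / κ) ≤ K_{p,q}(φ; Ω)` (`QuasiconformalData.phiFactor_le`); with this bound the distortion
inequality becomes the Hölder estimate. It says that `f ↦ f ∘ φ` is bounded from `L¹_p` to `L¹_q`.
Pointwise, `|Df(φ) Dφ| ≤ K_p * |J| ^ (1 / p) * |Df(φ)|`, so Hölder's inequality reduces it to
`∫ |J| * |Df(φ)| ^ p ≤ ∫ |Df| ^ p` (`eLpNorm_comp_clm_le`). That is an area inequality for an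
injective map which is differentiable almost everywhere (`lintegral_enorm_det_mul_comp_le`), and
`φ` is such a map because Morrey's inequality, applied to `φ` minus an affine map, gives
differentiability at the Lebesgue points of `|Dφ - A| ^ q` (`IsWeakFDeriv.ae_hasFDerivAt`).
The same estimate gives the chain rule for `f ∘ φ` (`IsWeakFDeriv.comp_of_memLp`): the weak
derivatives of `f_k ∘ φ`, for mollifications `f_k` of `f`, converge in `L^q`.

Morrey's inequality is first proved for smooth functions, by integrating along segments inside a
ball and contracting the ball towards the base point (`lintegral_cond_enorm_sub_le`), and then
transferred to weakly differentiable functions by mollification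
(`IsWeakFDeriv.exists_contDiff_approx`).
-/

/-! ### Weak derivatives: cutoffs, smooth functions and uniqueness -/

section WeakDerivative

variable {n : ℕ} {F : Type*} [NormedAddCommGroup F] [NormedSpace ℝ F]

theorem exists_contDiff_cutoff {K Ω : Set (RSpace n)} (hK : IsCompact K) (hΩ : IsOpen Ω)
    (hKΩ : K ⊆ Ω) :
    ∃ (η : RSpace n → ℝ) (U : Set (RSpace n)), ContDiff ℝ ∞ η ∧ HasCompactSupport η ∧
      tsupport η ⊆ Ω ∧ (∀ x, η x ∈ Set.Icc 0 1) ∧ IsOpen U ∧ K ⊆ U ∧ ∀ x ∈ U, η x = 1 := by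
  obtain ⟨L, hL, hKL, hLΩ⟩ := exists_compact_between hK hΩ hKΩ
  obtain ⟨f, h1, h0, hf⟩ := exists_contMDiffMap_one_nhds_of_subset_interior (n := ⊤)
    (modelWithCornersSelf ℝ (RSpace n)) hK.isClosed hKL
  have hsupp : tsupport f ⊆ L := closure_minimal
    (fun x hx => by by_contra h; exact hx (h0 x h)) hL.isClosed
  obtain ⟨U, hU, hKU, hUf⟩ := mem_nhdsSet_iff_exists.1 h1
  exact ⟨f, U, f.contMDiff.contDiff, hL.of_isClosed_subset (isClosed_tsupport _) hsupp,
    hsupp.trans hLΩ, hf, hU, hKU, hUf⟩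

/-- The product of a continuous function with compact support in `Ω` and a function that is
locally integrable on `Ω` is integrable on the whole space. -/
theorem integrable_bilin_of_tsupport_subset {E₁ E₂ E₃ : Type*}
    [NormedAddCommGroup E₁] [NormedSpace ℝ E₁] [NormedAddCommGroup E₂] [NormedSpace ℝ E₂]
    [NormedAddCommGroup E₃] [NormedSpace ℝ E₃] (B : E₁ →L[ℝ] E₂ →L[ℝ] E₃)
    {Ω : Set (RSpace n)} {g : RSpace n → E₁} {f : RSpace n → E₂} (hg : Continuous g)
    (hgc : HasCompactSupport g) (hgΩ : tsupport g ⊆ Ω) (hf : LocallyIntegrableOn f Ω volume) :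
    Integrable (fun x => B (g x) (f x)) volume := by
  have hfi : IntegrableOn f (tsupport g) volume :=
    hf.integrableOn_compact_subset hgΩ hgc
  obtain ⟨C, hC⟩ := hg.bounded_above_of_compact_support hgc
  have : IntegrableOn (fun x => B (g x) (f x)) (tsupport g) volume :=
    B.integrable_of_bilin_of_bdd_left C
      (hg.stronglyMeasurable_of_hasCompactSupport hgc).aestronglyMeasurable
      (Filter.Eventually.of_forall hC) hfi
  refine (integrableOn_iff_integrable_of_support_subset fun x hx => ?_).1 this
  by_contra h
  exact hx (by simp [image_eq_zero_of_notMem_tsupport h])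

theorem integrable_smul_of_tsupport_subset
    {Ω : Set (RSpace n)} {g : RSpace n → ℝ} {f : RSpace n → F} (hg : Continuous g)
    (hgc : HasCompactSupport g) (hgΩ : tsupport g ⊆ Ω) (hf : LocallyIntegrableOn f Ω volume) :
    Integrable (fun x => g x • f x) volume :=
  integrable_bilin_of_tsupport_subset (ContinuousLinearMap.lsmul ℝ ℝ) hg hgc hgΩ hf

theorem ContDiff.continuous_fderiv_apply_const {ψ : RSpace n → F} (h : ContDiff ℝ 1 ψ)
    (v : RSpace n) : Continuous fun x => fderiv ℝ ψ x v :=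
  (h.continuous_fderiv one_ne_zero).clm_apply continuous_const

/-- The integrals in the definition of the weak derivative may be taken over the whole space. -/
theorem IsWeakFDeriv.integral_eq {Ω : Set (RSpace n)} {f : RSpace n → F}
    {D : RSpace n → RSpace n →L[ℝ] F} (h : IsWeakFDeriv Ω f D) {ψ : RSpace n → ℝ}
    (hψ : ContDiff ℝ ∞ ψ) (hc : HasCompactSupport ψ) (hs : tsupport ψ ⊆ Ω) (v : RSpace n) :
    ∫ x, (fderiv ℝ ψ x v) • f x = -∫ x, ψ x • D x v := by
  have := h.2.2 ψ hψ hc hs v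
  rwa [setIntegral_eq_integral_of_forall_compl_eq_zero,
    setIntegral_eq_integral_of_forall_compl_eq_zero] at this
  · intro x hx
    rw [image_eq_zero_of_notMem_tsupport (fun h => hx (hs h)), zero_smul]
  · intro x hx
    have := image_eq_zero_of_notMem_tsupport
      (fun h => hx (hs (tsupport_fderiv_apply_subset ℝ v h)))
    rw [this, zero_smul]

theorem isWeakFDeriv_of_integral_eq {Ω : Set (RSpace n)} {f : RSpace n → F}
    {D : RSpace n → RSpace n →L[ℝ] F} (hf : LocallyIntegrableOn f Ω volume)
    (hD : LocallyIntegrableOn D Ω volume)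
    (h : ∀ ψ : RSpace n → ℝ, ContDiff ℝ ∞ ψ → HasCompactSupport ψ → tsupport ψ ⊆ Ω →
      ∀ v : RSpace n, ∫ x, (fderiv ℝ ψ x v) • f x = -∫ x, ψ x • D x v) :
    IsWeakFDeriv Ω f D := by
  refine ⟨hf, hD, fun ψ hψ hc hs v => ?_⟩
  rw [setIntegral_eq_integral_of_forall_compl_eq_zero,
    setIntegral_eq_integral_of_forall_compl_eq_zero]
  · exact h ψ hψ hc hs v
  · intro x hx
    rw [image_eq_zero_of_notMem_tsupport (fun h => hx (hs h)), zero_smul]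
  · intro x hx
    have := image_eq_zero_of_notMem_tsupport
      (fun h => hx (hs (tsupport_fderiv_apply_subset ℝ v h)))
    rw [this, zero_smul]

theorem IsWeakFDeriv.mono {Ω A : Set (RSpace n)} {f : RSpace n → F}
    {D : RSpace n → RSpace n →L[ℝ] F} (h : IsWeakFDeriv Ω f D) (hA : A ⊆ Ω) :
    IsWeakFDeriv A f D :=
  isWeakFDeriv_of_integral_eq (h.1.mono_set hA) (h.2.1.mono_set hA)
    fun _ hψ hc hs v => h.integral_eq hψ hc (hs.trans hA) v

theorem ContDiff.isWeakFDeriv {f : RSpace n → F} (hf : ContDiff ℝ 1 f) (Ω : Set (RSpace n)) :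
    IsWeakFDeriv Ω f (fderiv ℝ f) := by
  have hl : LocallyIntegrableOn f Ω volume := hf.continuous.locallyIntegrable.locallyIntegrableOn _
  have hl' : LocallyIntegrableOn (fderiv ℝ f) Ω volume :=
    (hf.continuous_fderiv one_ne_zero).locallyIntegrable.locallyIntegrableOn _
  refine isWeakFDeriv_of_integral_eq hl hl' fun ψ hψ hc hs v => ?_
  have hψ1 : ContDiff ℝ 1 ψ := hψ.of_le (by exact_mod_cast le_top)
  have hlv : LocallyIntegrableOn (fun x => fderiv ℝ f x v) Ω volume :=
    (hf.continuous_fderiv_apply_const v).locallyIntegrable.locallyIntegrableOn _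
  have key := integral_bilinear_hasFDerivAt_right_eq_neg_left_of_integrable
    (μ := (volume : Measure (RSpace n))) (f := ψ) (f' := fderiv ℝ ψ) (g := f) (g' := fderiv ℝ f)
    (v := v) (B := ContinuousLinearMap.lsmul ℝ ℝ)
    (integrable_smul_of_tsupport_subset (hψ1.continuous_fderiv_apply_const v)
      (hc.fderiv_apply ℝ v) ((tsupport_fderiv_apply_subset ℝ v).trans hs) hl)
    (integrable_smul_of_tsupport_subset hψ1.continuous hc hs hlv)
    (integrable_smul_of_tsupport_subset hψ1.continuous hc hs hl)
    (fun x _ => (hψ1.differentiable one_ne_zero x).hasFDerivAt)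
    (fun x _ => (hf.differentiable one_ne_zero x).hasFDerivAt)
  simp only [ContinuousLinearMap.lsmul_apply] at key
  rw [key, neg_neg]

theorem locallyIntegrableOn_clm_apply {Ω : Set (RSpace n)} {D : RSpace n → RSpace n →L[ℝ] F}
    (h : LocallyIntegrableOn D Ω volume) (v : RSpace n) :
    LocallyIntegrableOn (fun x => D x v) Ω volume := fun x hx => by
  obtain ⟨t, ht, hi⟩ := h x hx
  exact ⟨t, ht, ContinuousLinearMap.integrable_comp (ContinuousLinearMap.apply ℝ F v) hi⟩

/-- Leibniz rule: multiplying by a cutoff function supported in `Ω` gives a function that is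
weakly differentiable on the whole space. -/
theorem IsWeakFDeriv.cutoff_smul {Ω : Set (RSpace n)} {f : RSpace n → F}
    {D : RSpace n → RSpace n →L[ℝ] F} (h : IsWeakFDeriv Ω f D) {η : RSpace n → ℝ}
    (hη : ContDiff ℝ ∞ η) (hc : HasCompactSupport η) (hs : tsupport η ⊆ Ω) :
    IsWeakFDeriv Set.univ (fun x => η x • f x)
      (fun x => η x • D x + (fderiv ℝ η x).smulRight (f x)) := by
  have hη1 : ContDiff ℝ 1 η := hη.of_le (by exact_mod_cast le_top)
  have i2 : Integrable (fun x => (fderiv ℝ η x).smulRight (f x)) volume :=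
    integrable_bilin_of_tsupport_subset
      (ContinuousLinearMap.smulRightL ℝ (RSpace n) F) (hη1.continuous_fderiv one_ne_zero)
      (hc.fderiv ℝ) ((tsupport_fderiv_subset ℝ).trans hs) h.1
  refine isWeakFDeriv_of_integral_eq
    ((integrable_smul_of_tsupport_subset hη.continuous hc hs
      h.1).locallyIntegrable.locallyIntegrableOn _)
    (((integrable_smul_of_tsupport_subset hη.continuous hc hs h.2.1).add
      i2).locallyIntegrable.locallyIntegrableOn _) fun ψ hψ hψc _ v => ?_
  have hψ1 : ContDiff ℝ 1 ψ := hψ.of_le (by exact_mod_cast le_top)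
  have hprod : tsupport (fun x => ψ x * η x) ⊆ tsupport η := tsupport_mul_subset_right
  have key := h.integral_eq (hψ.mul hη) hc.mul_left (hprod.trans hs) v
  have hfd : ∀ x, fderiv ℝ (fun x => ψ x * η x) x v
      = fderiv ℝ ψ x v * η x + ψ x * fderiv ℝ η x v := fun x => by
    rw [fderiv_fun_mul (hψ1.differentiable one_ne_zero x) (hη1.differentiable one_ne_zero x)]
    simp; ring
  simp only [hfd, add_smul] at key
  have s1 : tsupport (fun x => fderiv ℝ ψ x v * η x) ⊆ Ω := tsupport_mul_subset_right.trans hs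
  have s2 : tsupport (fun x => ψ x * fderiv ℝ η x v) ⊆ Ω :=
    tsupport_mul_subset_right.trans ((tsupport_fderiv_apply_subset ℝ v).trans hs)
  have i3 : Integrable (fun x => (fderiv ℝ ψ x v * η x) • f x) volume :=
    integrable_smul_of_tsupport_subset
    ((hψ1.continuous_fderiv_apply_const v).mul hη.continuous) hc.mul_left s1 h.1
  have i4 : Integrable (fun x => (ψ x * fderiv ℝ η x v) • f x) volume :=
    integrable_smul_of_tsupport_subset
    (hψ1.continuous.mul (hη1.continuous_fderiv_apply_const v))
    ((hc.fderiv_apply ℝ v).mul_left) s2 h.1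
  have i5 : Integrable (fun x => (ψ x * η x) • D x v) volume :=
    integrable_smul_of_tsupport_subset (hψ1.continuous.mul hη.continuous) hc.mul_left
    (hprod.trans hs) (locallyIntegrableOn_clm_apply h.2.1 v)
  rw [integral_add i3 i4] at key
  have e1 : ∫ x, ψ x • (η x • D x + (fderiv ℝ η x).smulRight (f x)) v
      = (∫ x, (ψ x * η x) • D x v) + ∫ x, (ψ x * fderiv ℝ η x v) • f x := by
    rw [← integral_add i5 i4]
    congr 1; ext x
    simp [smul_smul]
  have e2 : ∫ x, (fderiv ℝ ψ x v) • η x • f x = ∫ x, (fderiv ℝ ψ x v * η x) • f x := by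
    simp only [smul_smul]
  rw [e1, e2, neg_add, ← key]
  abel

/-- If `f` vanishes outside a compact subset of `Ω`, its extension by zero is weakly
differentiable on the whole space, with a weak derivative `η • D` for some cutoff function `η`. -/
theorem IsWeakFDeriv.exists_cutoff_extension {Ω K : Set (RSpace n)} {f : RSpace n → F}
    {D : RSpace n → RSpace n →L[ℝ] F} (h : IsWeakFDeriv Ω f D) (hΩ : IsOpen Ω)
    (hK : IsCompact K) (hKΩ : K ⊆ Ω) (hf : ∀ x ∈ Ω, x ∉ K → f x = 0) :
    ∃ η : RSpace n → ℝ, Continuous η ∧ HasCompactSupport η ∧ tsupport η ⊆ Ω ∧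
      (∀ x, η x ∈ Set.Icc 0 1) ∧
      IsWeakFDeriv Set.univ (Ω.indicator f) (fun x => η x • D x) := by
  obtain ⟨η, U, hη, hc, hs, hη01, hU, hKU, hη1⟩ := exists_contDiff_cutoff hK hΩ hKΩ
  refine ⟨η, hη.continuous, hc, hs, hη01, ?_⟩
  have e1 : (fun x => η x • f x) = Ω.indicator f := by
    ext x
    by_cases hx : x ∈ Ω
    · rw [Set.indicator_of_mem hx]
      by_cases hxK : x ∈ K
      · rw [hη1 x (hKU hxK), one_smul]
      · rw [hf x hx hxK, smul_zero]
    · rw [Set.indicator_of_notMem hx, image_eq_zero_of_notMem_tsupport (fun h => hx (hs h)),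
        zero_smul]
  have e2 : (fun x => η x • D x + (fderiv ℝ η x).smulRight (f x)) = fun x => η x • D x := by
    ext1 x
    suffices (fderiv ℝ η x).smulRight (f x) = 0 by rw [this, add_zero]
    by_cases hx : x ∈ Ω
    · by_cases hxK : x ∈ K
      · have : η =ᶠ[nhds x] fun _ => 1 :=
          Filter.eventually_of_mem (hU.mem_nhds (hKU hxK)) hη1
        rw [this.fderiv_eq]; simp
      · rw [hf x hx hxK]; simp
    · rw [image_eq_zero_of_notMem_tsupport
        (fun h => hx (hs (tsupport_fderiv_subset ℝ h)))]
      simp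
  have := h.cutoff_smul hη hc hs
  rwa [e1, e2] at this

theorem IsWeakFDeriv.ae_eq [CompleteSpace F] {Ω : Set (RSpace n)} {f : RSpace n → F}
    {D D' : RSpace n → RSpace n →L[ℝ] F} (hΩ : IsOpen Ω) (h : IsWeakFDeriv Ω f D)
    (h' : IsWeakFDeriv Ω f D') : D =ᵐ[volume.restrict Ω] D' := by
  have := hΩ.ae_eq_zero_of_integral_contDiff_smul_eq_zero (h.2.1.sub h'.2.1) (μ := volume)
    fun ψ hψ hc hs => by
      have i1 := integrable_smul_of_tsupport_subset hψ.continuous hc hs h.2.1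
      have i2 := integrable_smul_of_tsupport_subset hψ.continuous hc hs h'.2.1
      simp only [Pi.sub_apply, smul_sub]
      rw [integral_sub i1 i2, sub_eq_zero]
      ext v
      rw [ContinuousLinearMap.integral_apply i1, ContinuousLinearMap.integral_apply i2]
      have := (h.integral_eq hψ hc hs v).symm.trans (h'.integral_eq hψ hc hs v)
      simpa using this
  filter_upwards [(ae_restrict_iff' hΩ.measurableSet).2 this] with x hx
  exact sub_eq_zero.1 hx

end WeakDerivative

/-! ### Approximation by mollification -/

section Mollification

variable {n : ℕ} {E : Type*} [NormedAddCommGroup E] [NormedSpace ℝ E]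

/-- Jensen's inequality for the convex function `t ↦ t ^ s` and a probability measure. -/
theorem lintegral_rpow_le_lintegral_rpow {α : Type*} [MeasurableSpace α] {ν : Measure α}
    [IsProbabilityMeasure ν] {s : ℝ} (hs : 1 ≤ s) {f : α → ℝ≥0∞} (hf : AEMeasurable f ν) :
    (∫⁻ a, f a ∂ν) ^ s ≤ ∫⁻ a, f a ^ s ∂ν := by
  have hs0 : 0 < s := by linarith
  have h := eLpNorm'_le_eLpNorm'_of_exponent_le (μ := ν) (f := f) one_pos hs
    hf.aestronglyMeasurable
  simp only [eLpNorm', ENNReal.rpow_one, enorm_eq_self, div_one] at h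
  calc (∫⁻ a, f a ∂ν) ^ s ≤ ((∫⁻ a, f a ^ s ∂ν) ^ (1 / s)) ^ s := by gcongr
    _ = ∫⁻ a, f a ^ s ∂ν := by
      rw [← ENNReal.rpow_mul, one_div, inv_mul_cancel₀ hs0.ne', ENNReal.rpow_one]

/-- Young's inequality: convolution with a normalized bump function is a contraction of `Lᵖ`. -/
theorem eLpNorm_normed_convolution_le (b : ContDiffBump (0 : RSpace n)) {p : ℝ≥0∞} (hp1 : 1 ≤ p)
    (hp : p ≠ ⊤) {g : RSpace n → E} (hg : AEStronglyMeasurable g volume) :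
    eLpNorm (convolution (b.normed volume) g (ContinuousLinearMap.lsmul ℝ ℝ) volume) p volume
      ≤ eLpNorm g p volume := by
  wlog hgs : StronglyMeasurable g generalizing g
  · have := this (g := hg.mk g) hg.stronglyMeasurable_mk.aestronglyMeasurable
      hg.stronglyMeasurable_mk
    rwa [← convolution_congr _ (Filter.EventuallyEq.refl _ _) hg.ae_eq_mk,
      ← eLpNorm_congr_ae hg.ae_eq_mk] at this
  have hp0 : p ≠ 0 := (one_pos.trans_le hp1).ne'
  have hs : 1 ≤ p.toReal := by
    rw [← ENNReal.toReal_one]; exact ENNReal.toReal_mono hp hp1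
  have hρm : Measurable fun t => ENNReal.ofReal (b.normed volume t) :=
    b.continuous_normed.measurable.ennreal_ofReal
  -- the mollified function is a mean with respect to the probability measure `ν`
  set ν : Measure (RSpace n) :=
    volume.withDensity fun t => ENNReal.ofReal (b.normed volume t) with hν
  have hprob : IsProbabilityMeasure ν := ⟨by
    rw [hν, withDensity_apply _ MeasurableSet.univ, setLIntegral_univ,
      ← ofReal_integral_eq_lintegral_ofReal b.integrable_normed
        (Filter.Eventually.of_forall b.nonneg_normed), b.integral_normed, ENNReal.ofReal_one]⟩
  have hgm : Measurable fun z : RSpace n × RSpace n => ‖g (z.1 - z.2)‖ₑ ^ p.toReal :=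
    ((hgs.comp_measurable measurable_sub).enorm).pow_const _
  have hpt : ∀ x, ‖convolution (b.normed volume) g (ContinuousLinearMap.lsmul ℝ ℝ) volume x‖ₑ
      ^ p.toReal ≤ ∫⁻ t, ‖g (x - t)‖ₑ ^ p.toReal ∂ν := fun x => by
    have hm : Measurable fun t => ‖g (x - t)‖ₑ :=
      (hgs.comp_measurable (measurable_const.sub measurable_id)).enorm
    refine le_trans ?_ (lintegral_rpow_le_lintegral_rpow hs hm.aemeasurable)
    gcongr
    rw [hν, lintegral_withDensity_eq_lintegral_mul _ hρm hm]
    refine (enorm_integral_le_lintegral_enorm _).trans (lintegral_mono fun t => ?_)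
    simp only [ContinuousLinearMap.lsmul_apply, Pi.mul_apply, enorm_smul]
    rw [Real.enorm_of_nonneg (b.nonneg_normed t)]
  rw [eLpNorm_eq_lintegral_rpow_enorm_toReal hp0 hp, eLpNorm_eq_lintegral_rpow_enorm_toReal hp0 hp]
  refine ENNReal.rpow_le_rpow ?_ (by positivity)
  calc _ ≤ ∫⁻ x, ∫⁻ t, ‖g (x - t)‖ₑ ^ p.toReal ∂ν := lintegral_mono hpt
    _ = ∫⁻ t, (∫⁻ x, ‖g (x - t)‖ₑ ^ p.toReal) ∂ν :=
      lintegral_lintegral_swap hgm.aemeasurable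
    _ = ∫⁻ _, (∫⁻ x, ‖g x‖ₑ ^ p.toReal) ∂ν := by
      congr 1; ext t
      exact lintegral_sub_right_eq_self (fun x => ‖g x‖ₑ ^ p.toReal) t
    _ = _ := by simp

theorem contDiff_normed_convolution (b : ContDiffBump (0 : RSpace n)) {g : RSpace n → E}
    (hg : LocallyIntegrable g volume) :
    ContDiff ℝ ∞ (convolution (b.normed volume) g (ContinuousLinearMap.lsmul ℝ ℝ) volume) :=
  b.hasCompactSupport_normed.contDiff_convolution_left _ b.contDiff_normed hg

/-- Mollifications converge in `Lᵖ`: by Young's inequality it is enough to check this on the dense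
set of continuous functions with compact support. -/
theorem exists_pos_forall_eLpNorm_convolution_sub_le [CompleteSpace E] {p : ℝ≥0∞} (hp1 : 1 ≤ p)
    (hp : p ≠ ⊤) {g : RSpace n → E} (hg : MemLp g p volume) {ε : ℝ≥0∞} (hε : ε ≠ 0) :
    ∃ δ > 0, ∀ b : ContDiffBump (0 : RSpace n), b.rOut ≤ δ →
      eLpNorm (convolution (b.normed volume) g (ContinuousLinearMap.lsmul ℝ ℝ) volume - g) p
        volume ≤ ε := by
  have hε3 : ε / 3 ≠ 0 := by simp [hε]
  obtain ⟨h, hhc, hgh, hcont, hh⟩ := hg.exists_hasCompactSupport_eLpNorm_sub_le hp hε3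
  set K := Metric.cthickening 1 (tsupport h)
  have hK : IsCompact K := hhc.isCompact.cthickening
  -- `c` is small enough for a function bounded by `c` on `K` to have small `Lᵖ` norm
  obtain ⟨c, hc, hcK⟩ : ∃ c : ℝ, 0 < c ∧
      ENNReal.ofReal c * volume K ^ (1 / p.toReal) ≤ ε / 3 := by
    have hV : volume K ^ (1 / p.toReal) ≠ ⊤ := ENNReal.rpow_ne_top_of_nonneg (by positivity)
      hK.measure_lt_top.ne
    obtain ⟨d, hd, hd2⟩ := ENNReal.exists_nnreal_pos_mul_lt hV hε3
    exact ⟨d, hd, by simpa using hd2.le⟩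
  obtain ⟨δ, hδ, hδu⟩ := Metric.uniformContinuous_iff.1
    (hcont.uniformContinuous_of_tendsto_cocompact (x := 0) hhc.is_zero_at_infty) c hc
  refine ⟨min δ 1, by positivity, fun b hb => ?_⟩
  have hli : LocallyIntegrable g volume := hg.locallyIntegrable hp1
  have hli' : LocallyIntegrable h volume := hcont.locallyIntegrable
  have ex1 : ConvolutionExists (b.normed volume) (g - h) (ContinuousLinearMap.lsmul ℝ ℝ) volume :=
    b.hasCompactSupport_normed.convolutionExists_left _ b.continuous_normed (hli.sub hli')
  have ex2 : ConvolutionExists (b.normed volume) h (ContinuousLinearMap.lsmul ℝ ℝ) volume :=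
    b.hasCompactSupport_normed.convolutionExists_left _ b.continuous_normed hli'
  have hsplit : convolution (b.normed volume) g (ContinuousLinearMap.lsmul ℝ ℝ) volume - g
      = convolution (b.normed volume) (g - h) (ContinuousLinearMap.lsmul ℝ ℝ) volume
        + ((convolution (b.normed volume) h (ContinuousLinearMap.lsmul ℝ ℝ) volume - h)
          + (h - g)) := by
    have := ex1.distrib_add ex2
    rw [sub_add_cancel] at this
    rw [this]; abel
  have hm1 := (contDiff_normed_convolution b (hli.sub hli')).continuous.aestronglyMeasurable
    (μ := volume)
  have hm2 := (contDiff_normed_convolution b hli').continuous.aestronglyMeasurable (μ := volume)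
  rw [hsplit]
  refine (eLpNorm_add_le hm1 ((hm2.sub hcont.aestronglyMeasurable).add
    (hcont.aestronglyMeasurable.sub hg.1)) hp1).trans ?_
  have t1 : eLpNorm (convolution (b.normed volume) (g - h) (ContinuousLinearMap.lsmul ℝ ℝ) volume)
      p volume ≤ ε / 3 :=
    (eLpNorm_normed_convolution_le b hp1 hp (hg.1.sub hcont.aestronglyMeasurable)).trans hgh
  have t3 : eLpNorm (h - g) p volume ≤ ε / 3 := by rwa [eLpNorm_sub_comm]
  have t2 : eLpNorm (convolution (b.normed volume) h (ContinuousLinearMap.lsmul ℝ ℝ) volume - h)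
      p volume ≤ ε / 3 := by
    refine (eLpNorm_sub_le_of_dist_bdd volume hp hK.measurableSet hc.le (fun x => ?_) ?_ ?_).trans
      hcK
    · refine b.dist_normed_convolution_le hcont.aestronglyMeasurable fun y hy => (hδu ?_).le
      exact (Metric.mem_ball.1 hy).trans_le (hb.trans (min_le_left _ _))
    · refine (support_convolution_subset _).trans ?_
      rintro _ ⟨a, ha, y, hy, rfl⟩
      rw [b.support_normed_eq] at ha
      refine Metric.mem_cthickening_of_dist_le _ y _ _ (subset_tsupport _ hy) ?_
      have : ‖a‖ < b.rOut := by simpa using ha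
      simpa [dist_eq_norm] using (this.trans_le (hb.trans (min_le_right _ _))).le
    · exact (subset_tsupport _).trans (Metric.self_subset_cthickening _)
  calc _ ≤ ε / 3 + (ε / 3 + ε / 3) := add_le_add t1
        ((eLpNorm_add_le (hm2.sub hcont.aestronglyMeasurable)
          (hcont.aestronglyMeasurable.sub hg.1) hp1).trans (add_le_add t2 t3))
    _ = ε := by rw [← add_assoc, ENNReal.add_thirds]

/-- Mollification commutes with weak differentiation. -/
theorem IsWeakFDeriv.hasFDerivAt_normed_convolution {u : RSpace n → E}
    [CompleteSpace E]
    {D : RSpace n → RSpace n →L[ℝ] E} (h : IsWeakFDeriv Set.univ u D)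
    (b : ContDiffBump (0 : RSpace n)) (x : RSpace n) :
    HasFDerivAt (convolution (b.normed volume) u (ContinuousLinearMap.lsmul ℝ ℝ) volume)
      (convolution (b.normed volume) D (ContinuousLinearMap.lsmul ℝ ℝ) volume x) x := by
  have hu : LocallyIntegrable u volume := locallyIntegrableOn_univ.1 h.1
  have hD : LocallyIntegrable D volume := locallyIntegrableOn_univ.1 h.2.1
  have hb1 : ContDiff ℝ 1 (b.normed volume) := b.contDiff_normed
  have hd := b.hasCompactSupport_normed.hasFDerivAt_convolution_left (μ := volume)
    (ContinuousLinearMap.lsmul ℝ ℝ) hb1 hu x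
  have ex1 : Integrable (fun t => ((ContinuousLinearMap.lsmul ℝ ℝ : ℝ →L[ℝ] E →L[ℝ] E).precompL
      (RSpace n)) (fderiv ℝ (b.normed volume) t) (u (x - t))) volume :=
    (b.hasCompactSupport_normed.fderiv ℝ).convolutionExists_left _
      (hb1.continuous_fderiv one_ne_zero) hu x
  have ex2 : Integrable (fun t => (ContinuousLinearMap.lsmul ℝ ℝ) (b.normed volume t) (D (x - t)))
      volume :=
    b.hasCompactSupport_normed.convolutionExists_left _ b.continuous_normed hD x
  refine hd.congr_fderiv (Eq.symm ?_)
  ext1 v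
  rw [convolution_def, convolution_def, ContinuousLinearMap.integral_apply ex1,
    ContinuousLinearMap.integral_apply ex2]
  simp only [ContinuousLinearMap.precompL_apply, ContinuousLinearMap.lsmul_apply,
    smul_apply]
  rw [← integral_sub_left_eq_self _ volume x,
    ← integral_sub_left_eq_self (fun t => (fderiv ℝ (b.normed volume) t v) • u (x - t)) volume x]
  simp only [sub_sub_cancel]
  -- test function `y ↦ ρ (x - y)`
  have hψ : ContDiff ℝ ∞ fun y => b.normed volume (x - y) :=
    b.contDiff_normed.comp (contDiff_const.sub contDiff_id)
  have hψc : HasCompactSupport fun y => b.normed volume (x - y) :=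
    b.hasCompactSupport_normed.comp_homeomorph (Homeomorph.subLeft x)
  have hψd : ∀ y, fderiv ℝ (fun y => b.normed volume (x - y)) y v
      = -fderiv ℝ (b.normed volume) (x - y) v := fun y => by
    have hd := (hb1.differentiable one_ne_zero (x - y)).hasFDerivAt.comp y
      ((hasFDerivAt_id y).const_sub x)
    rw [show (fun y => b.normed volume (x - y)) = b.normed volume ∘ HSub.hSub x from rfl,
      hd.fderiv]
    simp
  have := h.integral_eq hψ hψc (Set.subset_univ _) v
  simp only [hψd, neg_smul, integral_neg, neg_inj] at this
  exact this.symm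

/-- A continuous compactly supported function with weak derivative in `Lᵖ` is approximated by
smooth functions, uniformly, with derivatives converging in `Lᵖ`. -/
theorem IsWeakFDeriv.exists_contDiff_approx [CompleteSpace E] {u : RSpace n → E}
    {D : RSpace n → RSpace n →L[ℝ] E} (h : IsWeakFDeriv Set.univ u D) (hu : Continuous u)
    (hc : HasCompactSupport u) {p : ℝ≥0∞} (hp1 : 1 ≤ p) (hp : p ≠ ⊤) (hD : MemLp D p volume)
    {ε : ℝ} (hε : 0 < ε) :
    ∃ w : RSpace n → E, ContDiff ℝ ∞ w ∧ HasCompactSupport w ∧ (∀ x, ‖w x - u x‖ ≤ ε) ∧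
      eLpNorm (fderiv ℝ w - D) p volume ≤ ENNReal.ofReal ε := by
  obtain ⟨δ, hδ, hδD⟩ := exists_pos_forall_eLpNorm_convolution_sub_le hp1 hp hD
    (ENNReal.ofReal_pos.2 hε).ne'
  obtain ⟨δ', hδ', hδu⟩ := Metric.uniformContinuous_iff.1
    (hu.uniformContinuous_of_tendsto_cocompact (x := 0) hc.is_zero_at_infty) ε hε
  let b : ContDiffBump (0 : RSpace n) := ⟨min δ δ' / 2, min δ δ', by positivity,
    half_lt_self (by positivity)⟩
  have hb : b.rOut = min δ δ' := rfl
  have hfd : fderiv ℝ (convolution (b.normed volume) u (ContinuousLinearMap.lsmul ℝ ℝ) volume)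
      = convolution (b.normed volume) D (ContinuousLinearMap.lsmul ℝ ℝ) volume :=
    funext fun x => (h.hasFDerivAt_normed_convolution b x).fderiv
  refine ⟨convolution (b.normed volume) u (ContinuousLinearMap.lsmul ℝ ℝ) volume,
    contDiff_normed_convolution b hu.locallyIntegrable,
    b.hasCompactSupport_normed.convolution _ hc, fun x => ?_, ?_⟩
  · rw [← dist_eq_norm]
    refine b.dist_normed_convolution_le hu.aestronglyMeasurable fun y hy => (hδu ?_).le
    exact (Metric.mem_ball.1 hy).trans_le (hb.le.trans (min_le_right _ _))
  · rw [hfd]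
    exact hδD b (hb.le.trans (min_le_left _ _))

end Mollification

/-! ### Morrey's inequality -/

section Morrey

variable {n : ℕ} {E : Type*} [NormedAddCommGroup E] [NormedSpace ℝ E]

open ProbabilityTheory in
theorem isProbabilityMeasure_cond_closedBall (c : RSpace n) {R : ℝ} (hR : 0 < R) :
    IsProbabilityMeasure (volume[|Metric.closedBall c R]) :=
  cond_isProbabilityMeasure_of_finite (Metric.measure_closedBall_pos _ _ hR).ne'
    measure_closedBall_lt_top.ne

theorem lintegral_comp_homothety {h : RSpace n → ℝ≥0∞} (hh : Measurable h) (x : RSpace n) {t : ℝ}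
    (ht : 0 < t) :
    ∫⁻ z, h (x + t • (z - x)) = ENNReal.ofReal ((t ^ n)⁻¹) * ∫⁻ z, h z := by
  have e : ∀ z, x + t • (z - x) = (x - t • x) + t • z := fun z => by rw [smul_sub]; abel
  simp only [e]
  have hm : Measurable fun z => h (x - t • x + z) := hh.comp (measurable_const_add _)
  have := Measure.map_addHaar_smul (volume : Measure (RSpace n)) ht.ne'
  calc ∫⁻ z, h (x - t • x + t • z)
      = ∫⁻ y, h (x - t • x + y) ∂(Measure.map (fun z => t • z) volume) :=
        (lintegral_map hm (measurable_const_smul t)).symm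
    _ = _ := by
      rw [this, lintegral_smul_measure, lintegral_add_left_eq_self, abs_of_pos (by positivity)]
      simp

/-- The constant `∫₀¹ t^(-n/q) dt` of Morrey's inequality. -/
noncomputable def morreyConst (n : ℕ) (q : ℝ) : ℝ≥0∞ :=
  ∫⁻ t in Set.Ioo (0 : ℝ) 1, ENNReal.ofReal ((t ^ n)⁻¹) ^ (1 / q)

theorem morreyConst_lt_top {q : ℝ} (hq : n < q) : morreyConst n q < ⊤ := by
  have hq0 : 0 < q := (Nat.cast_nonneg n).trans_lt hq
  have hi : IntegrableOn (fun t : ℝ => t ^ (-(n / q))) (Set.Ioo 0 1) :=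
    (intervalIntegral.integrableOn_Ioo_rpow_iff one_pos).2
      (neg_lt_neg ((div_lt_one hq0).2 hq))
  refine lt_of_le_of_lt (le_of_eq ?_) hi.lintegral_lt_top
  refine setLIntegral_congr_fun measurableSet_Ioo fun t ht => ?_
  rw [ENNReal.ofReal_rpow_of_nonneg (by have := ht.1; positivity) (by positivity)]
  congr 1
  rw [← Real.rpow_natCast, ← Real.rpow_neg ht.1.le, ← Real.rpow_mul ht.1.le]
  congr 1; ring

open ProbabilityTheory in
/-- The mean over a ball of the deviation from the value at one of its points. It is estimated by
integrating the derivative along the segments to that point, and contracting the ball. -/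
theorem lintegral_cond_enorm_sub_le {u : RSpace n → E} (hu : ContDiff ℝ 1 u) {q : ℝ} (hq : 1 ≤ q)
    {c x : RSpace n} {R : ℝ} (hR : 0 < R) (hx : x ∈ Metric.closedBall c R) :
    ∫⁻ z, ‖u z - u x‖ₑ ∂(volume[|Metric.closedBall c R]) ≤
      ENNReal.ofReal (2 * R) * (morreyConst n q *
        (∫⁻ z, ‖fderiv ℝ u z‖ₑ ^ q ∂(volume[|Metric.closedBall c R])) ^ (1 / q)) := by
  set B := Metric.closedBall c R with hB
  set m : Measure (RSpace n) := volume[|B] with hm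
  have hq0 : 0 < q := by linarith
  have hprob : IsProbabilityMeasure m := isProbabilityMeasure_cond_closedBall c hR
  have hBm : MeasurableSet B := measurableSet_closedBall
  have hcont : Continuous fun z => ‖fderiv ℝ u z‖ₑ := (hu.continuous_fderiv one_ne_zero).enorm
  have hpath : Measurable fun z : ℝ × RSpace n => ‖fderiv ℝ u (x + z.1 • (z.2 - x))‖ₑ :=
    (hcont.comp (by fun_prop)).measurable
  -- fundamental theorem of calculus along the segment from `x` to `z`
  have hpt : ∀ᵐ z ∂m, ‖u z - u x‖ₑ ≤ ENNReal.ofReal (2 * R) *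
      ∫⁻ t in Set.Ioo (0 : ℝ) 1, ‖fderiv ℝ u (x + t • (z - x))‖ₑ := by
    have hmem : ∀ᵐ z ∂m, z ∈ B := ae_cond_mem hBm
    filter_upwards [hmem] with z hz
    have hd : ∀ t : ℝ, HasDerivAt (fun t : ℝ => u (x + t • (z - x)))
        (fderiv ℝ u (x + t • (z - x)) (z - x)) t := fun t => by
      have h1 : HasDerivAt (fun t : ℝ => x + t • (z - x)) (z - x) t := by
        simpa using ((hasDerivAt_id t).smul_const (z - x)).const_add x
      exact (hu.differentiable one_ne_zero _).hasFDerivAt.comp_hasDerivAt t h1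
    have h := enorm_sub_le_lintegral_deriv_of_contDiffOn_Icc (a := 0) (b := 1)
      (f := fun t : ℝ => u (x + t • (z - x)))
      (hu.comp (by fun_prop)).contDiffOn zero_le_one
    simp only [one_smul, add_sub_cancel, zero_smul, add_zero] at h
    refine h.trans ?_
    rw [setLIntegral_congr Ioo_ae_eq_Icc.symm,
      ← lintegral_const_mul' _ _ ENNReal.ofReal_ne_top]
    refine lintegral_mono fun t => ?_
    rw [(hd t).deriv, mul_comm]
    refine (ContinuousLinearMap.le_opENorm _ _).trans ?_
    gcongr
    rw [← ofReal_norm]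
    refine ENNReal.ofReal_le_ofReal ?_
    rw [← dist_eq_norm]
    calc dist z x ≤ dist z c + dist x c := dist_triangle_right _ _ _
      _ ≤ 2 * R := by
        have h1 := Metric.mem_closedBall.1 hz
        have h2 := Metric.mem_closedBall.1 hx
        linarith
  -- the contraction `z ↦ x + t • (z - x)` maps the ball into itself, with Jacobian `t ^ n`
  have hscale : ∀ t ∈ Set.Ioo (0 : ℝ) 1, ∫⁻ z, ‖fderiv ℝ u (x + t • (z - x))‖ₑ ∂m ≤
      ENNReal.ofReal ((t ^ n)⁻¹) ^ (1 / q) * (∫⁻ z, ‖fderiv ℝ u z‖ₑ ^ q ∂m) ^ (1 / q) := by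
    intro t ht
    have hmt : Measurable fun z => ‖fderiv ℝ u (x + t • (z - x))‖ₑ :=
      (hcont.comp (by fun_prop)).measurable
    have h1 := lintegral_rpow_le_lintegral_rpow (ν := m) hq hmt.aemeasurable
    rw [← ENNReal.mul_rpow_of_nonneg _ _ (by positivity), one_div,
      ENNReal.le_rpow_inv_iff hq0]
    refine h1.trans ?_
    rw [hm, ProbabilityTheory.cond, lintegral_smul_measure, lintegral_smul_measure,
      smul_eq_mul, smul_eq_mul, mul_left_comm]
    gcongr
    have hind : Measurable (B.indicator fun z => ‖fderiv ℝ u z‖ₑ ^ q) :=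
      (hcont.measurable.pow_const q).indicator hBm
    rw [← lintegral_indicator hBm, ← lintegral_indicator hBm,
      ← lintegral_comp_homothety hind x ht.1]
    refine lintegral_mono fun z => ?_
    by_cases hz : z ∈ B
    · have : x + t • (z - x) ∈ B :=
        (convex_closedBall c R).add_smul_sub_mem hx hz ⟨ht.1.le, ht.2.le⟩
      rw [Set.indicator_of_mem hz, Set.indicator_of_mem this]
    · rw [Set.indicator_of_notMem hz]; exact zero_le
  calc ∫⁻ z, ‖u z - u x‖ₑ ∂m
      ≤ ∫⁻ z, ENNReal.ofReal (2 * R) *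
          (∫⁻ t in Set.Ioo (0 : ℝ) 1, ‖fderiv ℝ u (x + t • (z - x))‖ₑ) ∂m := lintegral_mono_ae hpt
    _ = ENNReal.ofReal (2 * R) *
          ∫⁻ z, (∫⁻ t in Set.Ioo (0 : ℝ) 1, ‖fderiv ℝ u (x + t • (z - x))‖ₑ) ∂m :=
        lintegral_const_mul' _ _ ENNReal.ofReal_ne_top
    _ = ENNReal.ofReal (2 * R) *
          ∫⁻ t in Set.Ioo (0 : ℝ) 1, (∫⁻ z, ‖fderiv ℝ u (x + t • (z - x))‖ₑ ∂m) := by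
        rw [lintegral_lintegral_swap]
        exact (hpath.comp measurable_swap).aemeasurable
    _ ≤ ENNReal.ofReal (2 * R) * ∫⁻ t in Set.Ioo (0 : ℝ) 1,
          ENNReal.ofReal ((t ^ n)⁻¹) ^ (1 / q) * (∫⁻ z, ‖fderiv ℝ u z‖ₑ ^ q ∂m) ^ (1 / q) := by
        gcongr 1
        exact setLIntegral_mono' measurableSet_Ioo hscale
    _ = _ := by
        rw [lintegral_mul_const]
        · rfl
        · exact ((measurable_id.pow_const n).inv.ennreal_ofReal).pow_const _

open ProbabilityTheory in
theorem ContDiff.enorm_sub_le_morrey {u : RSpace n → E} (hu : ContDiff ℝ 1 u) {q : ℝ}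
    (hq : 1 ≤ q) {c x y : RSpace n} {R : ℝ} (hR : 0 < R) (hx : x ∈ Metric.closedBall c R)
    (hy : y ∈ Metric.closedBall c R) :
    ‖u x - u y‖ₑ ≤ ENNReal.ofReal (4 * R) * (morreyConst n q *
        (∫⁻ z, ‖fderiv ℝ u z‖ₑ ^ q ∂(volume[|Metric.closedBall c R])) ^ (1 / q)) := by
  have := isProbabilityMeasure_cond_closedBall c hR
  have hm : Measurable fun z => ‖u z - u x‖ₑ :=
    (hu.continuous.sub continuous_const).enorm.measurable
  calc ‖u x - u y‖ₑ = ∫⁻ _, ‖u x - u y‖ₑ ∂(volume[|Metric.closedBall c R]) := by simp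
    _ ≤ ∫⁻ z, (‖u z - u x‖ₑ + ‖u z - u y‖ₑ) ∂(volume[|Metric.closedBall c R]) := by
        refine lintegral_mono fun z => ?_
        rw [← edist_eq_enorm_sub, ← edist_eq_enorm_sub, ← edist_eq_enorm_sub]
        exact edist_triangle_left _ _ _
    _ ≤ _ := by
        rw [lintegral_add_left hm]
        refine (add_le_add (lintegral_cond_enorm_sub_le hu hq hR hx)
          (lintegral_cond_enorm_sub_le hu hq hR hy)).trans (le_of_eq ?_)
        rw [← add_mul, ← ENNReal.ofReal_add (by positivity) (by positivity)]
        congr 2; ring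

open ProbabilityTheory in
theorem lintegral_cond_rpow_eq_eLpNorm {G : Type*} [NormedAddCommGroup G] (s : Set (RSpace n))
    {q : ℝ} (hq : 0 < q)
    (g : RSpace n → G) :
    (∫⁻ z, ‖g z‖ₑ ^ q ∂(volume[|s])) ^ (1 / q)
      = (volume s)⁻¹ ^ (1 / q) * eLpNorm g (ENNReal.ofReal q) (volume.restrict s) := by
  rw [eLpNorm_eq_lintegral_rpow_enorm_toReal (by simpa using hq) ENNReal.ofReal_ne_top,
    ENNReal.toReal_ofReal hq.le, ← ENNReal.mul_rpow_of_nonneg _ _ (by positivity),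
    ProbabilityTheory.cond,
    lintegral_smul_measure, smul_eq_mul]

open ProbabilityTheory in
/-- Morrey's inequality on a ball, for a weakly differentiable function with an affine function
subtracted. -/
theorem IsWeakFDeriv.enorm_sub_le_morrey [CompleteSpace E] {u : RSpace n → E}
    {D : RSpace n → RSpace n →L[ℝ] E} (h : IsWeakFDeriv Set.univ u D) (hu : Continuous u)
    (hc : HasCompactSupport u) {q : ℝ} (hq : 1 ≤ q) (hnq : n < q)
    (hD : MemLp D (ENNReal.ofReal q) volume) (A : RSpace n →L[ℝ] E)
    {c x y : RSpace n} {R : ℝ} (hR : 0 < R)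
    (hx : x ∈ Metric.closedBall c R) (hy : y ∈ Metric.closedBall c R) :
    ‖(u x - u y) - A (x - y)‖ₑ ≤ ENNReal.ofReal (4 * R) * (morreyConst n q *
        (∫⁻ z, ‖D z - A‖ₑ ^ q ∂(volume[|Metric.closedBall c R])) ^ (1 / q)) := by
  have hq0 : 0 < q := by linarith
  have hq1 : 1 ≤ ENNReal.ofReal q := by simpa using hq
  have happ : ∀ k : ℕ, ∃ w : RSpace n → E, ContDiff ℝ ∞ w ∧ HasCompactSupport w ∧
      (∀ x, ‖w x - u x‖ ≤ 1 / ((k : ℝ) + 1)) ∧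
      eLpNorm (fderiv ℝ w - D) (ENNReal.ofReal q) volume ≤ ENNReal.ofReal (1 / ((k : ℝ) + 1)) :=
    fun k => h.exists_contDiff_approx hu hc hq1 ENNReal.ofReal_ne_top hD (by positivity)
  choose w hw _ hwu hwD using happ
  have hlim : Filter.Tendsto (fun k : ℕ => 1 / ((k : ℝ) + 1)) Filter.atTop (nhds 0) :=
    tendsto_one_div_add_atTop_nhds_zero_nat
  have hwlim : ∀ x, Filter.Tendsto (fun k => w k x) Filter.atTop (nhds (u x)) := fun x =>
    tendsto_iff_norm_sub_tendsto_zero.2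
      (squeeze_zero (fun _ => norm_nonneg _) (fun k => hwu k x) hlim)
  have hB : volume (Metric.closedBall c R) ≠ 0 := (Metric.measure_closedBall_pos _ _ hR).ne'
  have hV : (volume (Metric.closedBall c R))⁻¹ ^ (1 / q) ≠ ⊤ :=
    ENNReal.rpow_ne_top_of_nonneg (by positivity) (ENNReal.inv_ne_top.2 hB)
  set V := (volume (Metric.closedBall c R))⁻¹ ^ (1 / q)
  set N := eLpNorm (fun z => D z - A) (ENNReal.ofReal q)
    (volume.restrict (Metric.closedBall c R))
  have hbound : ∀ k : ℕ, ‖(w k x - w k y) - A (x - y)‖ₑ ≤ ENNReal.ofReal (4 * R) *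
      (morreyConst n q * (V * (ENNReal.ofReal (1 / ((k : ℝ) + 1)) + N))) := by
    intro k
    have hw1 : ContDiff ℝ 1 (w k) := (hw k).of_le (by exact_mod_cast le_top)
    have hcd : ContDiff ℝ 1 (fun z => w k z - A z) := hw1.sub A.contDiff
    have hfd : fderiv ℝ (fun z => w k z - A z) = fun z => fderiv ℝ (w k) z - A := by
      ext1 z
      rw [fderiv_fun_sub (hw1.differentiable one_ne_zero z) A.differentiableAt, A.fderiv]
    have key := hcd.enorm_sub_le_morrey hq hR hx hy
    rw [hfd, lintegral_cond_rpow_eq_eLpNorm _ hq0] at key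
    have e : w k x - A x - (w k y - A y) = (w k x - w k y) - A (x - y) := by
      rw [map_sub]; abel
    rw [e] at key
    refine key.trans ?_
    gcongr
    have e2 : (fun z => fderiv ℝ (w k) z - A) = (fderiv ℝ (w k) - D) + fun z => D z - A := by
      ext1 z; simp
    have hm1 : AEStronglyMeasurable (fderiv ℝ (w k) - D) volume :=
      (hw1.continuous_fderiv one_ne_zero).aestronglyMeasurable.sub hD.1
    rw [e2]
    refine (eLpNorm_add_le hm1.restrict (hD.1.sub aestronglyMeasurable_const).restrict hq1).trans ?_
    exact add_le_add
      ((eLpNorm_mono_measure _ Measure.restrict_le_self).trans (hwD k)) le_rfl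
  rw [lintegral_cond_rpow_eq_eLpNorm _ hq0]
  have hl : Filter.Tendsto (fun k => ‖(w k x - w k y) - A (x - y)‖ₑ) Filter.atTop
      (nhds ‖(u x - u y) - A (x - y)‖ₑ) :=
    (((hwlim x).sub (hwlim y)).sub tendsto_const_nhds).enorm
  have hr : Filter.Tendsto (fun k : ℕ => ENNReal.ofReal (4 * R) *
      (morreyConst n q * (V * (ENNReal.ofReal (1 / ((k : ℝ) + 1)) + N)))) Filter.atTop
      (nhds (ENNReal.ofReal (4 * R) * (morreyConst n q * (V * (0 + N))))) := by
    have h0 : Filter.Tendsto (fun k : ℕ => ENNReal.ofReal (1 / ((k : ℝ) + 1)) + N) Filter.atTop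
        (nhds (0 + N)) := by
      refine Filter.Tendsto.add ?_ tendsto_const_nhds
      simpa using ENNReal.tendsto_ofReal hlim
    exact ENNReal.Tendsto.const_mul (ENNReal.Tendsto.const_mul (ENNReal.Tendsto.const_mul h0
      (Or.inr hV)) (Or.inr (morreyConst_lt_top hnq).ne)) (Or.inr ENNReal.ofReal_ne_top)
  have := le_of_tendsto_of_tendsto' hl hr hbound
  rwa [zero_add] at this

end Morrey

/-! ### Almost everywhere differentiability and the change of variables -/

section Differentiability

variable {n : ℕ} {E : Type*} [NormedAddCommGroup E] [NormedSpace ℝ E]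

open ProbabilityTheory in
/-- Lebesgue points of `‖D - A‖ ^ q`. -/
theorem ae_tendsto_lintegral_cond_rpow {G : Type*} [NormedAddCommGroup G] {q : ℝ} (hq : 1 ≤ q)
    {D : RSpace n → G} (hD : MemLp D (ENNReal.ofReal q) volume) (A : G) :
    ∀ᵐ x ∂(volume : Measure (RSpace n)), Filter.Tendsto
      (fun r => (∫⁻ z, ‖D z - A‖ₑ ^ q ∂(volume[|Metric.closedBall x r])) ^ (1 / q))
      (nhdsWithin 0 (Set.Ioi 0)) (nhds ‖D x - A‖ₑ) := by
  have hq0 : 0 < q := by linarith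
  have hli : LocallyIntegrable (fun z => ‖D z - A‖ ^ q) (volume : Measure (RSpace n)) := by
    rw [locallyIntegrable_iff]
    intro K hK
    have : IsFiniteMeasure ((volume : Measure (RSpace n)).restrict K) :=
      ⟨by simpa using hK.measure_lt_top⟩
    have h1 : MemLp (fun z => D z - A) (ENNReal.ofReal q) (volume.restrict K) :=
      (hD.restrict K).sub (memLp_const A)
    have := h1.integrable_norm_rpow (by simpa using hq0) ENNReal.ofReal_ne_top
    rwa [ENNReal.toReal_ofReal hq0.le] at this
  filter_upwards [(Besicovitch.vitaliFamily volume).ae_tendsto_average hli] with x hx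
  have h1 := hx.comp (Besicovitch.tendsto_filterAt volume x)
  have h2 := (ENNReal.tendsto_ofReal h1).ennrpow_const (1 / q)
  have e0 : ENNReal.ofReal (‖D x - A‖ ^ q) ^ (1 / q) = ‖D x - A‖ₑ := by
    rw [← ENNReal.ofReal_rpow_of_nonneg (norm_nonneg _) hq0.le, ofReal_norm, ← ENNReal.rpow_mul,
      mul_one_div_cancel hq0.ne', ENNReal.rpow_one]
  rw [e0] at h2
  refine h2.congr fun r => ?_
  congr 1
  have hfin : IntegrableOn (fun z => ‖D z - A‖ ^ q) (Metric.closedBall x r) :=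
    hli.integrableOn_isCompact (isCompact_closedBall x r)
  simp only [Function.comp_apply]
  rw [ofReal_setAverage hfin (Filter.Eventually.of_forall fun z => by positivity),
    ProbabilityTheory.cond, lintegral_smul_measure, smul_eq_mul, ENNReal.div_eq_inv_mul]
  congr 2
  ext z
  rw [← ENNReal.ofReal_rpow_of_nonneg (norm_nonneg _) hq0.le, ofReal_norm]

open ProbabilityTheory in
/-- A weakly differentiable function with derivative in `L^q`, `q > n`, is differentiable at the
Lebesgue points of its derivative, with the same derivative. -/
theorem IsWeakFDeriv.ae_hasFDerivAt_of_hasCompactSupport [FiniteDimensional ℝ E] {u : RSpace n → E}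
    {D : RSpace n → RSpace n →L[ℝ] E} (h : IsWeakFDeriv Set.univ u D) (hu : Continuous u)
    (hc : HasCompactSupport u) {q : ℝ} (hq : 1 ≤ q) (hnq : n < q)
    (hD : MemLp D (ENNReal.ofReal q) volume) :
    ∀ᵐ x ∂(volume : Measure (RSpace n)), HasFDerivAt u (D x) x := by
  have : CompleteSpace E := FiniteDimensional.complete ℝ E
  have : ProperSpace (RSpace n →L[ℝ] E) := FiniteDimensional.proper_real _
  obtain ⟨S, hSc, hSd⟩ := TopologicalSpace.exists_countable_dense (RSpace n →L[ℝ] E)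
  have hall : ∀ᵐ x ∂(volume : Measure (RSpace n)), ∀ A ∈ S, Filter.Tendsto
      (fun r => (∫⁻ z, ‖D z - A‖ₑ ^ q ∂(volume[|Metric.closedBall x r])) ^ (1 / q))
      (nhdsWithin 0 (Set.Ioi 0)) (nhds ‖D x - A‖ₑ) :=
    (ae_ball_iff hSc).2 fun A _ => ae_tendsto_lintegral_cond_rpow hq hD A
  filter_upwards [hall] with x hx
  rw [hasFDerivAt_iff_isLittleO, Asymptotics.isLittleO_iff]
  intro ε hε
  set C := (morreyConst n q).toReal with hC
  have hC0 : 0 ≤ C := ENNReal.toReal_nonneg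
  -- the total error is at most `(4 * C + 1) * δ` times the increment
  set δ := ε / (4 * C + 1) with hδ
  have hδ0 : 0 < δ := by positivity
  -- a map `A` of the countable dense set replaces `D x`, so that only countably many Lebesgue
  -- point conditions are needed
  obtain ⟨A, hAS, hA⟩ := Metric.dense_iff.1 hSd (D x) δ hδ0
  have hAD : ‖D x - A‖ < δ := by rw [← dist_eq_norm, dist_comm]; exact hAS
  have hAD' : ‖D x - A‖ₑ < ENNReal.ofReal δ := by
    rw [← ofReal_norm]; exact (ENNReal.ofReal_lt_ofReal_iff hδ0).2 hAD
  have hev := (hx A hA).eventually (gt_mem_nhds hAD')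
  rw [eventually_nhdsWithin_iff, Metric.eventually_nhds_iff] at hev
  obtain ⟨η, hη, hηr⟩ := hev
  filter_upwards [Metric.ball_mem_nhds x hη] with y hy
  rcases eq_or_ne y x with rfl | hyx
  · simp
  have hr : 0 < ‖y - x‖ := norm_pos_iff.2 (sub_ne_zero.2 hyx)
  have hav := hηr (y := ‖y - x‖) (by simpa [dist_eq_norm] using hy) hr
  have hM := h.enorm_sub_le_morrey hu hc hq hnq hD A (c := x) (x := y) (y := x) hr
    (by simp [dist_eq_norm]) (by simp)
  have hM2 : ‖(u y - u x) - A (y - x)‖ ≤ 4 * ‖y - x‖ * (C * δ) := by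
    have hM3 : ‖(u y - u x) - A (y - x)‖ₑ ≤ ENNReal.ofReal (4 * ‖y - x‖ * (C * δ)) := by
      refine hM.trans ?_
      rw [ENNReal.ofReal_mul (p := 4 * ‖y - x‖) (by positivity), ENNReal.ofReal_mul hC0, hC,
        ENNReal.ofReal_toReal (morreyConst_lt_top hnq).ne]
      gcongr
    rw [← ofReal_norm] at hM3
    exact (ENNReal.ofReal_le_ofReal_iff (by positivity)).1 hM3
  calc ‖u y - u x - (D x) (y - x)‖
      = ‖(u y - u x - A (y - x)) - (D x - A) (y - x)‖ := by
        rw [sub_apply]; congr 1; abel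
    _ ≤ 4 * ‖y - x‖ * (C * δ) + δ * ‖y - x‖ :=
        (norm_sub_le _ _).trans (add_le_add hM2
          (((D x - A).le_opNorm _).trans (by gcongr)))
    _ = ε * ‖y - x‖ := by rw [hδ]; field_simp

theorem memLp_bilin_of_hasCompactSupport {E₁ E₂ E₃ : Type*}
    [NormedAddCommGroup E₁] [NormedSpace ℝ E₁] [NormedAddCommGroup E₂] [NormedSpace ℝ E₂]
    [NormedAddCommGroup E₃] [NormedSpace ℝ E₃] (B : E₁ →L[ℝ] E₂ →L[ℝ] E₃) {p : ℝ≥0∞}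
    {g : RSpace n → E₁} {f : RSpace n → E₂} (hg : Continuous g)
    (hgc : HasCompactSupport g) (hf : MemLp f p (volume.restrict (tsupport g))) :
    MemLp (fun x => B (g x) (f x)) p volume := by
  obtain ⟨C, hC⟩ := hg.bounded_above_of_compact_support hgc
  have hgL : MemLp g ⊤ (volume.restrict (tsupport g)) := memLp_top_of_bound
    (hg.stronglyMeasurable_of_hasCompactSupport hgc).aestronglyMeasurable C
    (Filter.Eventually.of_forall hC)
  have h : MemLp (fun x => B (g x) (f x)) p (volume.restrict (tsupport g)) :=
    B.memLp_of_bilin p hgL hf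
  rw [← memLp_indicator_iff_restrict (isClosed_tsupport g).measurableSet] at h
  rwa [Set.indicator_eq_self.2] at h
  intro x hx
  by_contra hn
  exact hx (by simp [image_eq_zero_of_notMem_tsupport hn])

theorem continuous_smul_of_tsupport_subset {Ω : Set (RSpace n)} (hΩ : IsOpen Ω)
    {η : RSpace n → ℝ} (hη : Continuous η) (hs : tsupport η ⊆ Ω) {f : RSpace n → E}
    (hf : ContinuousOn f Ω) : Continuous fun x => η x • f x := by
  refine continuous_of_tsupport fun x hx => ?_
  have hxΩ : x ∈ Ω := hs (tsupport_smul_subset_left η f hx)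
  exact hη.continuousAt.smul (hf.continuousAt (hΩ.mem_nhds hxΩ))

theorem memLp_cutoff_smul {Ω : Set (RSpace n)} {f : RSpace n → E}
    {D : RSpace n → RSpace n →L[ℝ] E} {p : ℝ≥0∞}
    (hL : ∀ K ⊆ Ω, IsCompact K → MemLp f p (volume.restrict K) ∧ MemLp D p (volume.restrict K))
    {η : RSpace n → ℝ} (hη : ContDiff ℝ ∞ η) (hc : HasCompactSupport η) (hs : tsupport η ⊆ Ω) :
    MemLp (fun x => η x • D x + (fderiv ℝ η x).smulRight (f x)) p volume := by
  have hs' : tsupport (fderiv ℝ η) ⊆ Ω := (tsupport_fderiv_subset ℝ).trans hs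
  exact (memLp_bilin_of_hasCompactSupport (ContinuousLinearMap.lsmul ℝ ℝ) hη.continuous hc
    (hL _ hs hc).2).add
    (memLp_bilin_of_hasCompactSupport (ContinuousLinearMap.smulRightL ℝ (RSpace n) E)
      (hη.continuous_fderiv (by simp)) (hc.fderiv ℝ) (hL _ hs' (hc.fderiv ℝ)).1)

theorem cutoff_smul_apply_of_eq_one {f : RSpace n → E} {D : RSpace n → RSpace n →L[ℝ] E}
    {η : RSpace n → ℝ} {U : Set (RSpace n)} (hU : IsOpen U) (h1 : ∀ x ∈ U, η x = 1)
    {x : RSpace n} (hx : x ∈ U) :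
    η x • D x + (fderiv ℝ η x).smulRight (f x) = D x := by
  have : η =ᶠ[nhds x] fun _ => 1 := Filter.eventually_of_mem (hU.mem_nhds hx) h1
  rw [this.fderiv_eq, h1 x hx]; simp

theorem IsWeakFDeriv.ae_hasFDerivAt [FiniteDimensional ℝ E] {Ω : Set (RSpace n)}
    (hΩ : IsOpen Ω) {f : RSpace n → E}
    {D : RSpace n → RSpace n →L[ℝ] E} (h : IsWeakFDeriv Ω f D) (hf : ContinuousOn f Ω)
    {q : ℝ} (hq : 1 ≤ q) (hnq : n < q)
    (hL : ∀ K ⊆ Ω, IsCompact K → MemLp f (ENNReal.ofReal q) (volume.restrict K) ∧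
      MemLp D (ENNReal.ofReal q) (volume.restrict K)) :
    ∀ᵐ x ∂(volume : Measure (RSpace n)), x ∈ Ω → HasFDerivAt f (D x) x := by
  rw [ae_iff]
  refine measure_null_of_locally_null _ fun x₀ hx₀ => ?_
  have hx₀Ω : x₀ ∈ Ω := by by_contra hn; exact hx₀ fun h => absurd h hn
  obtain ⟨η, U, hη, hc, hs, -, hU, hKU, hη1⟩ :=
    exists_contDiff_cutoff isCompact_singleton hΩ (Set.singleton_subset_iff.2 hx₀Ω)
  have hglob := (h.cutoff_smul hη hc hs).ae_hasFDerivAt_of_hasCompactSupport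
    (continuous_smul_of_tsupport_subset hΩ hη.continuous hs hf) hc.smul_right hq hnq
    (memLp_cutoff_smul hL hη hc hs)
  refine ⟨_, inter_mem_nhdsWithin _ (hU.mem_nhds (hKU rfl)), ?_⟩
  refine measure_mono_null ?_ (ae_iff.1 hglob)
  rintro x ⟨hx, hxU⟩ hd
  refine hx fun _ => ?_
  rw [cutoff_smul_apply_of_eq_one hU hη1 hxU] at hd
  exact hd.congr_of_eventuallyEq (Filter.eventually_of_mem (hU.mem_nhds hxU)
    fun y hy => by simp [hη1 y hy])

/-- The change of variables inequality for an injective map that is differentiable almost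
everywhere. It needs no Lusin condition, because the image of the exceptional null set is simply
discarded on the right-hand side. -/
theorem lintegral_enorm_det_mul_comp_le {Ω : Set (RSpace n)} (hΩ : IsOpen Ω)
    {φ : RSpace n → RSpace n} (hinj : Set.InjOn φ Ω) {D : RSpace n → RSpace n →L[ℝ] RSpace n}
    (hd : ∀ᵐ x ∂(volume : Measure (RSpace n)), x ∈ Ω → HasFDerivAt φ (D x) x)
    (g : RSpace n → ℝ≥0∞) :
    ∫⁻ x in Ω, ‖(D x).det‖ₑ * g (φ x) ≤ ∫⁻ y, g y := by
  set N := toMeasurable volume {x | ¬ (x ∈ Ω → HasFDerivAt φ (D x) x)} with hN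
  have hN0 : volume N = 0 := by rw [hN, measure_toMeasurable]; exact ae_iff.1 hd
  set s := Ω \ N with hs
  have hsm : MeasurableSet s := hΩ.measurableSet.diff (measurableSet_toMeasurable _ _)
  have hsΩ : s =ᵐ[volume] Ω := sdiff_null_ae_eq_self hN0
  have hds : ∀ x ∈ s, HasFDerivWithinAt φ (D x) s x := fun x hx => by
    by_contra hn
    exact hx.2 (subset_toMeasurable _ _ fun h => hn (h hx.1).hasFDerivWithinAt)
  calc ∫⁻ x in Ω, ‖(D x).det‖ₑ * g (φ x) = ∫⁻ x in s, ‖(D x).det‖ₑ * g (φ x) :=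
        setLIntegral_congr hsΩ.symm
    _ = ∫⁻ y in φ '' s, g y := by
        rw [lintegral_image_eq_lintegral_abs_det_fderiv_mul volume hsm hds
          (hinj.mono Set.sdiff_subset)]
        simp only [← Real.norm_eq_abs, ofReal_norm]
    _ ≤ ∫⁻ y, g y := setLIntegral_le_lintegral _ _

end Differentiability

/-! ### The chain rule -/

section ChainRule

variable {n : ℕ}

/-- Integrals of products pass to the limit when one factor converges boundedly almost everywhere
and the other one in `L¹`. -/
theorem tendsto_integral_clm_apply {α : Type*} [MeasurableSpace α] {μ : Measure α}
    {E₂ E₃ : Type*} [NormedAddCommGroup E₂] [NormedSpace ℝ E₂] [NormedAddCommGroup E₃]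
    [NormedSpace ℝ E₃] {a : ℕ → α → E₂ →L[ℝ] E₃} {a' : α → E₂ →L[ℝ] E₃} {X : ℕ → α → E₂}
    {X' : α → E₂} {C : ℝ} (ham : ∀ k, AEStronglyMeasurable (a k) μ) (haC : ∀ k x, ‖a k x‖ ≤ C)
    (hlim : ∀ᵐ x ∂μ, Filter.Tendsto (fun k => a k x) Filter.atTop (nhds (a' x)))
    (hX : ∀ k, AEStronglyMeasurable (X k) μ) (hX' : Integrable X' μ)
    (hXlim : Filter.Tendsto (fun k => eLpNorm (X k - X') 1 μ) Filter.atTop (nhds 0)) :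
    Filter.Tendsto (fun k => ∫ x, a k x (X k x) ∂μ) Filter.atTop (nhds (∫ x, a' x (X' x) ∂μ)) := by
  have hC : ∀ x, 0 ≤ C := fun x => (norm_nonneg _).trans (haC 0 x)
  -- the part with `X'` converges by dominated convergence
  have h1 : Filter.Tendsto (fun k => ∫ x, a k x (X' x) ∂μ) Filter.atTop
      (nhds (∫ x, a' x (X' x) ∂μ)) := by
    refine tendsto_integral_of_dominated_convergence (fun x => C * ‖X' x‖)
      (fun k => ((ContinuousLinearMap.id ℝ (E₂ →L[ℝ] E₃)).aestronglyMeasurable_comp₂ (ham k)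
        hX'.1)) (hX'.norm.const_mul C)
      (fun k => Filter.Eventually.of_forall fun x => (a k x).le_of_opNorm_le (haC k x) _) ?_
    filter_upwards [hlim] with x hx
    exact ((ContinuousLinearMap.apply ℝ E₃ (X' x)).continuous.tendsto _).comp hx
  have hev : ∀ᶠ k in Filter.atTop, eLpNorm (X k - X') 1 μ < ⊤ :=
    hXlim.eventually (gt_mem_nhds ENNReal.zero_lt_top)
  have h2 : Filter.Tendsto (fun k => ∫ x, a k x (X k x - X' x) ∂μ) Filter.atTop (nhds 0) := by
    rw [tendsto_iff_edist_tendsto_0]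
    have hlimC : Filter.Tendsto (fun k => ENNReal.ofReal C * eLpNorm (X k - X') 1 μ) Filter.atTop
        (nhds 0) := by
      simpa using ENNReal.Tendsto.const_mul hXlim (Or.inr ENNReal.ofReal_ne_top)
    refine tendsto_of_tendsto_of_tendsto_of_le_of_le tendsto_const_nhds hlimC
      (fun _ => zero_le) fun k => ?_
    simp only [edist_zero_right]
    refine (enorm_integral_le_lintegral_enorm _).trans ?_
    rw [eLpNorm_one_eq_lintegral_enorm, ← lintegral_const_mul' _ _ ENNReal.ofReal_ne_top]
    refine lintegral_mono fun x => ((a k x).le_opENorm _).trans ?_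
    rw [Pi.sub_apply]
    gcongr
    rw [← ofReal_norm]
    exact ENNReal.ofReal_le_ofReal (haC k x)
  have h3 := h1.add h2
  rw [add_zero] at h3
  refine h3.congr' ?_
  filter_upwards [hev] with k hk
  have hsub : Integrable (X k - X') μ := memLp_one_iff_integrable.1 ⟨(hX k).sub hX'.1, hk⟩
  rw [← integral_add]
  · simp
  · exact (ContinuousLinearMap.id ℝ (E₂ →L[ℝ] E₃)).integrable_of_bilin_of_bdd_left C (ham k)
      (Filter.Eventually.of_forall (haC k)) hX'
  · exact (ContinuousLinearMap.id ℝ (E₂ →L[ℝ] E₃)).integrable_of_bilin_of_bdd_left C (ham k)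
      (Filter.Eventually.of_forall (haC k)) hsub

theorem locallyIntegrableOn_clm_comp {Ω : Set (RSpace n)} (hΩ : IsOpen Ω) {φ : RSpace n → RSpace n}
    (hφ : ContinuousOn φ Ω) {D : RSpace n → RSpace n →L[ℝ] RSpace n}
    (hD : LocallyIntegrableOn D Ω volume) {G : RSpace n → RSpace n →L[ℝ] ℝ} (hG : Continuous G)
    {C : ℝ} (hC : ∀ x, ‖G x‖ ≤ C) :
    LocallyIntegrableOn (fun x => (G (φ x)).comp (D x)) Ω volume := by
  rw [locallyIntegrableOn_iff hΩ.isLocallyClosed]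
  intro K hK hKc
  exact (ContinuousLinearMap.compL ℝ (RSpace n) (RSpace n) ℝ).integrable_of_bilin_of_bdd_left C
    ((hG.comp_continuousOn (hφ.mono hK)).aestronglyMeasurable hKc.measurableSet)
    (Filter.Eventually.of_forall fun x => hC _) (hD.integrableOn_compact_subset hK hKc)

/-- Chain rule for a smooth outer function. -/
theorem IsWeakFDeriv.comp_contDiff {Ω : Set (RSpace n)} (hΩ : IsOpen Ω)
    {φ : RSpace n → RSpace n} (hφ : ContinuousOn φ Ω) {D : RSpace n → RSpace n →L[ℝ] RSpace n}
    (h : IsWeakFDeriv Ω φ D) {f : RSpace n → ℝ} (hf : ContDiff ℝ ∞ f) (hfc : HasCompactSupport f) :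
    IsWeakFDeriv Ω (f ∘ φ) (fun x => (fderiv ℝ f (φ x)).comp (D x)) := by
  have hf1 : ContDiff ℝ 1 f := hf.of_le (by exact_mod_cast le_top)
  have hfd := hf1.continuous_fderiv one_ne_zero
  obtain ⟨M, hM⟩ := hf.continuous.bounded_above_of_compact_support hfc
  obtain ⟨M', hM'⟩ := hfd.bounded_above_of_compact_support (hfc.fderiv ℝ)
  refine isWeakFDeriv_of_integral_eq
    ((hf.continuous.comp_continuousOn hφ).locallyIntegrableOn hΩ.measurableSet)
    (locallyIntegrableOn_clm_comp hΩ hφ h.2.1 hfd hM') fun ψ hψ hψc hψs v => ?_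
  have hψ1 : ContDiff ℝ 1 ψ := hψ.of_le (by exact_mod_cast le_top)
  obtain ⟨η, U, hη, hc, hs, -, hU, hKU, hη1⟩ := exists_contDiff_cutoff hψc hΩ hψs
  set u := fun x => η x • φ x with hu
  set D' := fun x => η x • D x + (fderiv ℝ η x).smulRight (φ x) with hD'
  have hucont : Continuous u := continuous_smul_of_tsupport_subset hΩ hη.continuous hs hφ
  have hL : MemLp D' 1 volume := memLp_cutoff_smul (fun K hK hKc =>
    ⟨memLp_one_iff_integrable.2 (h.1.integrableOn_compact_subset hK hKc),
      memLp_one_iff_integrable.2 (h.2.1.integrableOn_compact_subset hK hKc)⟩) hη hc hs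
  have happ : ∀ k : ℕ, ∃ w : RSpace n → RSpace n, ContDiff ℝ ∞ w ∧ HasCompactSupport w ∧
      (∀ x, ‖w x - u x‖ ≤ 1 / ((k : ℝ) + 1)) ∧
      eLpNorm (fderiv ℝ w - D') 1 volume ≤ ENNReal.ofReal (1 / ((k : ℝ) + 1)) :=
    fun k => (h.cutoff_smul hη hc hs).exists_contDiff_approx hucont hc.smul_right le_rfl
      ENNReal.one_ne_top hL (by positivity)
  choose w hw _ hwu hwD using happ
  have hlim : Filter.Tendsto (fun k : ℕ => 1 / ((k : ℝ) + 1)) Filter.atTop (nhds 0) :=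
    tendsto_one_div_add_atTop_nhds_zero_nat
  have hwlim : ∀ x, Filter.Tendsto (fun k => w k x) Filter.atTop (nhds (u x)) := fun x =>
    tendsto_iff_norm_sub_tendsto_zero.2
      (squeeze_zero (fun _ => norm_nonneg _) (fun k => hwu k x) hlim)
  have hw1 : ∀ k, ContDiff ℝ 1 (w k) := fun k => (hw k).of_le (by exact_mod_cast le_top)
  have hψi : Integrable (fun x => fderiv ℝ ψ x v) volume :=
    (hψ1.continuous_fderiv_apply_const v).integrable_of_hasCompactSupport (hψc.fderiv_apply ℝ v)
  have lim1 : Filter.Tendsto (fun k => ∫ x, (fderiv ℝ ψ x v) • f (w k x)) Filter.atTop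
      (nhds (∫ x, (fderiv ℝ ψ x v) • f (u x))) := by
    refine tendsto_integral_of_dominated_convergence (fun x => ‖fderiv ℝ ψ x v‖ * M)
      (fun k => ((hψ1.continuous_fderiv_apply_const v).smul
        (hf.continuous.comp (hw k).continuous)).aestronglyMeasurable)
      (hψi.norm.mul_const M) (fun k => Filter.Eventually.of_forall fun x => ?_)
      (Filter.Eventually.of_forall fun x => ?_)
    · rw [norm_smul]
      gcongr
      exact hM _
    · exact tendsto_const_nhds.smul ((hf.continuous.tendsto _).comp (hwlim x))
  obtain ⟨P, hP⟩ := hψ.continuous.bounded_above_of_compact_support hψc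
  have lim2 : Filter.Tendsto
      (fun k => ∫ x, (ψ x • fderiv ℝ f (w k x)) (fderiv ℝ (w k) x v)) Filter.atTop
      (nhds (∫ x, (ψ x • fderiv ℝ f (u x)) (D' x v))) := by
    have hvm : ∀ k, AEStronglyMeasurable (fun x => fderiv ℝ (w k) x v) volume := fun k =>
      ((hw1 k).continuous_fderiv_apply_const v).aestronglyMeasurable
    refine tendsto_integral_clm_apply (a := fun k x => ψ x • fderiv ℝ f (w k x))
      (X := fun k x => fderiv ℝ (w k) x v) (X' := fun x => D' x v) (C := P * M')
      (fun k => (hψ.continuous.smul (hfd.comp (hw k).continuous)).aestronglyMeasurable)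
      (fun k x => ?_) (Filter.Eventually.of_forall fun x => ?_) hvm
      (ContinuousLinearMap.integrable_comp (ContinuousLinearMap.apply ℝ (RSpace n) v)
        (memLp_one_iff_integrable.1 hL)) ?_
    · rw [norm_smul]
      exact mul_le_mul (hP x) (hM' _) (norm_nonneg _) ((norm_nonneg _).trans (hP x))
    · exact tendsto_const_nhds.smul ((hfd.tendsto _).comp (hwlim x))
    · have hz : Filter.Tendsto (fun k : ℕ => ENNReal.ofReal ‖v‖ *
          ENNReal.ofReal (1 / ((k : ℝ) + 1))) Filter.atTop (nhds 0) := by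
        have := ENNReal.Tendsto.const_mul (a := ENNReal.ofReal ‖v‖) (ENNReal.tendsto_ofReal hlim)
          (Or.inr ENNReal.ofReal_ne_top)
        simpa using this
      refine tendsto_of_tendsto_of_tendsto_of_le_of_le tendsto_const_nhds hz
        (fun _ => zero_le) fun k => ?_
      refine (eLpNorm_le_mul_eLpNorm_of_ae_le_mul (Filter.Eventually.of_forall fun x => ?_) 1).trans
        (mul_le_mul_right (hwD k) _)
      rw [mul_comm]
      exact (fderiv ℝ (w k) x - D' x).le_opNorm v
  have heq : ∀ k, ∫ x, (fderiv ℝ ψ x v) • f (w k x)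
      = -∫ x, (ψ x • fderiv ℝ f (w k x)) (fderiv ℝ (w k) x v) := fun k => by
    have := ((hf1.comp (hw1 k)).isWeakFDeriv Set.univ).integral_eq hψ hψc (Set.subset_univ _) v
    simp only [Function.comp_apply] at this
    rw [this]
    congr 2; ext x
    rw [fderiv_comp x (hf1.differentiable one_ne_zero _) ((hw1 k).differentiable one_ne_zero _)]
    simp
  have huniq := tendsto_nhds_unique lim1 (lim2.neg.congr fun k => (heq k).symm)
  -- on the support of `ψ` the cutoff is invisible
  have e1 : ∫ x, (fderiv ℝ ψ x v) • (f ∘ φ) x = ∫ x, (fderiv ℝ ψ x v) • f (u x) := by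
    congr 1; ext x
    by_cases hx : x ∈ tsupport ψ
    · simp [hu, hη1 x (hKU hx)]
    · have : fderiv ℝ ψ x v = 0 := image_eq_zero_of_notMem_tsupport
        (f := fun x => fderiv ℝ ψ x v) fun h => hx (tsupport_fderiv_apply_subset ℝ v h)
      simp [this]
  have e2 : ∫ x, ψ x • ((fderiv ℝ f (φ x)).comp (D x)) v
      = ∫ x, (ψ x • fderiv ℝ f (u x)) (D' x v) := by
    congr 1; ext x
    by_cases hx : x ∈ tsupport ψ
    · have hxU := hKU hx
      have h1 : D' x = D x := cutoff_smul_apply_of_eq_one hU hη1 hxU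
      rw [h1]
      simp [hu, hη1 x hxU]
    · simp [image_eq_zero_of_notMem_tsupport hx]
  rw [e1, e2, huniq]

end ChainRule

/-! ### The composition operator -/

section Composition

variable {n : ℕ}

/-- The conventions `0 / 0 = 0` and `a / 0 = ∞` of `ℝ≥0∞` agree with the degenerate cases of the
`p`-dilatation. -/
theorem pDilatation_eq_div (p : ℝ) (hp : 0 < p) (T : RSpace n →L[ℝ] RSpace n) :
    pDilatation p T = ‖T‖ₑ / ‖T.det‖ₑ ^ (1 / p) := by
  unfold pDilatation
  rcases eq_or_ne (‖T.det‖ₑ ^ (1 / p)) 0 with h0 | h0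
  · rw [h0]
    rcases eq_or_ne ‖T‖ₑ 0 with hT | hT
    · simp [hT]
    · rw [ENNReal.div_zero hT]
      simp [hT]
  · have ht : ‖T.det‖ₑ ^ (1 / p) ≠ ⊤ :=
      ENNReal.rpow_ne_top_of_nonneg (by positivity) enorm_ne_top
    simp_rw [← ENNReal.div_le_iff h0 ht]
    exact csInf_Ici

theorem enorm_le_pDilatation_mul {p : ℝ} (hp : 0 < p) {T : RSpace n →L[ℝ] RSpace n}
    (hT : T.det = 0 → T = 0) : ‖T‖ₑ ≤ pDilatation p T * ‖T.det‖ₑ ^ (1 / p) := by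
  rw [pDilatation_eq_div p hp]
  by_cases h0 : T.det = 0
  · rw [hT h0, ← ofReal_norm, norm_zero, ENNReal.ofReal_zero]
    exact zero_le
  · rw [ENNReal.div_mul_cancel]
    · simp [ENNReal.rpow_eq_zero_iff, h0]
    · exact ENNReal.rpow_ne_top_of_nonneg (by positivity) enorm_ne_top

theorem aemeasurable_pDilatation {p : ℝ} (hp : 0 < p) {μ : Measure (RSpace n)}
    {D : RSpace n → RSpace n →L[ℝ] RSpace n} (hD : AEStronglyMeasurable D μ) :
    AEMeasurable (fun x => pDilatation p (D x)) μ := by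
  simp only [pDilatation_eq_div p hp]
  exact hD.enorm.div
    ((ContinuousLinearMap.continuous_det.comp_aestronglyMeasurable hD).enorm.pow_const _)

/-- Hölder's inequality with the exponents `1 / q = 1 / κ + 1 / p`, including `κ = ∞`. -/
theorem lintegral_mul_rpow_le_kappa {p q : ℝ} (hq : 0 < q) (hqp : q ≤ p)
    {μ : Measure (RSpace n)} {k m : RSpace n → ℝ≥0∞} (hk : AEMeasurable k μ)
    (hm : AEMeasurable m μ) :
    (∫⁻ x, (k x * m x) ^ q ∂μ) ^ (1 / q) ≤
      eLpNorm k (kappa p q) μ * (∫⁻ x, m x ^ p ∂μ) ^ (1 / p) := by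
  have hp : 0 < p := hq.trans_le hqp
  rcases hqp.eq_or_lt with rfl | hlt
  · have hκ : kappa q q = ⊤ := by simp [kappa]
    rw [hκ, eLpNorm_exponent_top]
    have hae : ∀ᵐ x ∂μ, (k x * m x) ^ q ≤ (eLpNormEssSup k μ) ^ q * m x ^ q := by
      filter_upwards [enorm_ae_le_eLpNormEssSup k μ] with x hx
      rw [← ENNReal.mul_rpow_of_nonneg _ _ hq.le]
      gcongr
      simpa using hx
    calc _ ≤ (∫⁻ x, (eLpNormEssSup k μ) ^ q * m x ^ q ∂μ) ^ (1 / q) := by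
          gcongr ?_ ^ _
          exact lintegral_mono_ae hae
      _ = _ := by
          rw [lintegral_const_mul'' _ (hm.pow_const q),
            ENNReal.mul_rpow_of_nonneg _ _ (by positivity), ← ENNReal.rpow_mul,
            mul_one_div_cancel hq.ne', ENNReal.rpow_one]
  · have hd : 0 < 1 / q - 1 / p := sub_pos.2 (one_div_lt_one_div_of_lt hq hlt)
    have hκ : kappa p q = ENNReal.ofReal (1 / q - 1 / p)⁻¹ := by
      rw [kappa, ENNReal.ofReal_inv_of_pos hd]
    rw [hκ, eLpNorm_eq_lintegral_rpow_enorm_toReal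
      (ENNReal.ofReal_pos.2 (inv_pos.2 hd)).ne' ENNReal.ofReal_ne_top,
      ENNReal.toReal_ofReal (inv_pos.2 hd).le, mul_comm]
    simp only [enorm_eq_self]
    have h := ENNReal.lintegral_Lp_mul_le_Lq_mul_Lr (p := q) (q := p) (r := (1 / q - 1 / p)⁻¹) hq
      hlt (by field_simp; ring) μ hm hk
    simp only [Pi.mul_apply] at h
    simpa only [mul_comm] using h

/-- The basic estimate: pulling back covector fields by `φ` is bounded from `L^p` to `L^q`. -/
theorem eLpNorm_comp_clm_le {p q : ℝ} (hq : 1 ≤ q) (hnq : n < q) (hqp : q ≤ p)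
    {Ω : Set (RSpace n)} (hΩ : IsOpen Ω) {φ : RSpace n → RSpace n} (hφ : ContinuousOn φ Ω)
    (hinj : Set.InjOn φ Ω) {D : RSpace n → RSpace n →L[ℝ] RSpace n} (h : IsWeakFDeriv Ω φ D)
    (hL : ∀ K ⊆ Ω, IsCompact K → MemLp φ (ENNReal.ofReal q) (volume.restrict K) ∧
      MemLp D (ENNReal.ofReal q) (volume.restrict K))
    (hfin : ∀ᵐ x ∂(volume.restrict Ω), (D x).det = 0 → D x = 0)
    {H : RSpace n → RSpace n →L[ℝ] ℝ} (hH : StronglyMeasurable H) :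
    eLpNorm (fun x => (H (φ x)).comp (D x)) (ENNReal.ofReal q) (volume.restrict Ω) ≤
      eLpNorm (fun x => pDilatation p (D x)) (kappa p q) (volume.restrict Ω) *
        eLpNorm H (ENNReal.ofReal p) volume := by
  have hq0 : 0 < q := by linarith
  have hp0 : 0 < p := hq0.trans_le hqp
  have hφm : AEMeasurable φ (volume.restrict Ω) := hφ.aemeasurable hΩ.measurableSet
  have hDm : AEStronglyMeasurable D (volume.restrict Ω) := h.2.1.aestronglyMeasurable
  have hdetm : AEMeasurable (fun x => ‖(D x).det‖ₑ) (volume.restrict Ω) :=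
    (ContinuousLinearMap.continuous_det.comp_aestronglyMeasurable hDm).enorm
  have hHm : AEMeasurable (fun x => ‖H (φ x)‖ₑ) (volume.restrict Ω) :=
    hH.enorm.comp_aemeasurable hφm
  rw [eLpNorm_eq_lintegral_rpow_enorm_toReal (by simpa using hq0) ENNReal.ofReal_ne_top,
    eLpNorm_eq_lintegral_rpow_enorm_toReal (by simpa using hp0) ENNReal.ofReal_ne_top,
    ENNReal.toReal_ofReal hq0.le, ENNReal.toReal_ofReal hp0.le]
  calc _ ≤ (∫⁻ x in Ω, (pDilatation p (D x) *
          (‖(D x).det‖ₑ ^ (1 / p) * ‖H (φ x)‖ₑ)) ^ q) ^ (1 / q) := by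
        gcongr ?_ ^ _
        refine lintegral_mono_ae ?_
        filter_upwards [hfin] with x hx
        gcongr
        refine (ContinuousLinearMap.opENorm_comp_le _ _).trans ?_
        rw [mul_comm, ← mul_assoc]
        gcongr
        exact enorm_le_pDilatation_mul hp0 hx
    _ ≤ _ := lintegral_mul_rpow_le_kappa hq0 hqp (aemeasurable_pDilatation hp0 hDm)
          ((hdetm.pow_const _).mul hHm)
    _ ≤ _ := by
        refine mul_le_mul' le_rfl (ENNReal.rpow_le_rpow ?_ (by positivity))
        refine le_trans (le_of_eq ?_) (lintegral_enorm_det_mul_comp_le hΩ hinj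
          (h.ae_hasFDerivAt hΩ hφ hq hnq hL) fun y => ‖H y‖ₑ ^ p)
        congr 1; ext x
        rw [ENNReal.mul_rpow_of_nonneg _ _ hp0.le, ← ENNReal.rpow_mul, one_div_mul_cancel hp0.ne',
          ENNReal.rpow_one]

/-- Chain rule for a weakly differentiable outer function whose derivative is in `L^p`. The
representative `G` of the derivative has to be measurable everywhere: a map `φ` without the Lusin
condition for preimages may pull a null set back to a set of positive measure, on which only
`Dφ = 0` saves the product. -/
theorem IsWeakFDeriv.comp_of_memLp {p q : ℝ} (hq : 1 ≤ q) (hnq : n < q) (hqp : q ≤ p)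
    {Ω : Set (RSpace n)} (hΩ : IsOpen Ω) {φ : RSpace n → RSpace n} (hφ : ContinuousOn φ Ω)
    (hinj : Set.InjOn φ Ω) {D : RSpace n → RSpace n →L[ℝ] RSpace n} (h : IsWeakFDeriv Ω φ D)
    (hL : ∀ K ⊆ Ω, IsCompact K → MemLp φ (ENNReal.ofReal q) (volume.restrict K) ∧
      MemLp D (ENNReal.ofReal q) (volume.restrict K))
    (hfin : ∀ᵐ x ∂(volume.restrict Ω), (D x).det = 0 → D x = 0)
    (hK : eLpNorm (fun x => pDilatation p (D x)) (kappa p q) (volume.restrict Ω) < ⊤)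
    {f : RSpace n → ℝ} (hf : Continuous f) (hfc : HasCompactSupport f)
    {G' G : RSpace n → RSpace n →L[ℝ] ℝ} (hfG : IsWeakFDeriv Set.univ f G')
    (hGm : StronglyMeasurable G) (hGG : G' =ᵐ[volume] G)
    (hG : MemLp G (ENNReal.ofReal p) volume) :
    IsWeakFDeriv Ω (f ∘ φ) (fun x => (G (φ x)).comp (D x)) := by
  have hp1 : 1 ≤ ENNReal.ofReal p := by simpa using hq.trans hqp
  have hq1 : 1 ≤ ENNReal.ofReal q := by simpa using hq
  set K := eLpNorm (fun x => pDilatation p (D x)) (kappa p q) (volume.restrict Ω) with hKdef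
  have hφm : AEMeasurable φ (volume.restrict Ω) := hφ.aemeasurable hΩ.measurableSet
  have hDm : AEStronglyMeasurable D (volume.restrict Ω) := h.2.1.aestronglyMeasurable
  have hcompm : ∀ {H : RSpace n → RSpace n →L[ℝ] ℝ}, StronglyMeasurable H →
      AEStronglyMeasurable (fun x => (H (φ x)).comp (D x)) (volume.restrict Ω) := fun {H} hH =>
    (ContinuousLinearMap.compL ℝ (RSpace n) (RSpace n) ℝ).aestronglyMeasurable_comp₂
      (hH.aestronglyMeasurable.comp_aemeasurable hφm) hDm
  have hY : MemLp (fun x => (G (φ x)).comp (D x)) (ENNReal.ofReal q) (volume.restrict Ω) :=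
    ⟨hcompm hGm, (eLpNorm_comp_clm_le hq hnq hqp hΩ hφ hinj h hL hfin hGm).trans_lt
      (ENNReal.mul_lt_top hK hG.2)⟩
  refine ⟨(hf.comp_continuousOn hφ).locallyIntegrableOn hΩ.measurableSet,
    locallyIntegrableOn_of_locallyIntegrable_restrict (hY.locallyIntegrable hq1),
    fun ψ hψ hψc hψs v => ?_⟩
  have hψ1 : ContDiff ℝ 1 ψ := hψ.of_le (by exact_mod_cast le_top)
  have happ : ∀ k : ℕ, ∃ w : RSpace n → ℝ, ContDiff ℝ ∞ w ∧ HasCompactSupport w ∧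
      (∀ x, ‖w x - f x‖ ≤ 1 / ((k : ℝ) + 1)) ∧
      eLpNorm (fderiv ℝ w - G') (ENNReal.ofReal p) volume ≤ ENNReal.ofReal (1 / ((k : ℝ) + 1)) :=
    fun k => hfG.exists_contDiff_approx hf hfc hp1 ENNReal.ofReal_ne_top
      ((memLp_congr_ae hGG).2 hG) (by positivity)
  choose w hw hwc hwf hwD using happ
  have hwG : ∀ k : ℕ, eLpNorm (fderiv ℝ (w k) - G) (ENNReal.ofReal p) volume
      ≤ ENNReal.ofReal (1 / ((k : ℝ) + 1)) := fun k => by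
    rw [← eLpNorm_congr_ae ((Filter.EventuallyEq.refl _ _).sub hGG)]; exact hwD k
  have hw1 : ∀ k, ContDiff ℝ 1 (w k) := fun k => (hw k).of_le (by exact_mod_cast le_top)
  have hwdm : ∀ k, StronglyMeasurable (fderiv ℝ (w k)) := fun k =>
    ((hw1 k).continuous_fderiv one_ne_zero).stronglyMeasurable
  have hlim : Filter.Tendsto (fun k : ℕ => 1 / ((k : ℝ) + 1)) Filter.atTop (nhds 0) :=
    tendsto_one_div_add_atTop_nhds_zero_nat
  have hwlim : ∀ x, Filter.Tendsto (fun k => w k x) Filter.atTop (nhds (f x)) := fun x =>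
    tendsto_iff_norm_sub_tendsto_zero.2
      (squeeze_zero (fun _ => norm_nonneg _) (fun k => hwf k x) hlim)
  have hψi : Integrable (fun x => fderiv ℝ ψ x v) volume :=
    (hψ1.continuous_fderiv_apply_const v).integrable_of_hasCompactSupport (hψc.fderiv_apply ℝ v)
  obtain ⟨M, hM⟩ := hf.bounded_above_of_compact_support hfc
  have lim1 : Filter.Tendsto (fun k => ∫ x in Ω, (fderiv ℝ ψ x v) • (w k ∘ φ) x) Filter.atTop
      (nhds (∫ x in Ω, (fderiv ℝ ψ x v) • (f ∘ φ) x)) := by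
    refine tendsto_integral_of_dominated_convergence (fun x => ‖fderiv ℝ ψ x v‖ * (M + 1))
      (fun k => (((hψ1.continuous_fderiv_apply_const v).continuousOn.smul
        ((hw k).continuous.comp_continuousOn hφ)).aestronglyMeasurable hΩ.measurableSet))
      (hψi.restrict.norm.mul_const _) (fun k => Filter.Eventually.of_forall fun x => ?_)
      (Filter.Eventually.of_forall fun x => ?_)
    · rw [norm_smul]
      gcongr
      calc ‖(w k ∘ φ) x‖ ≤ ‖f (φ x)‖ + ‖w k (φ x) - f (φ x)‖ := norm_le_insert' _ _
        _ ≤ M + 1 := add_le_add (hM _) ((hwf k _).trans (by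
            rw [div_le_one (by positivity)]; linarith [(Nat.cast_nonneg k : (0 : ℝ) ≤ k)]))
    · exact tendsto_const_nhds.smul (hwlim _)
  obtain ⟨P, hP⟩ := hψ.continuous.bounded_above_of_compact_support hψc
  -- the right-hand sides live on the compact support of `ψ`
  have hres : ∀ Z : RSpace n → RSpace n →L[ℝ] ℝ, ∫ x in Ω, ψ x • Z x v
      = ∫ x in tsupport ψ, ψ x • Z x v := fun Z =>
    setIntegral_eq_of_subset_of_forall_sdiff_eq_zero hΩ.measurableSet hψs fun x hx => by
      rw [image_eq_zero_of_notMem_tsupport hx.2, zero_smul]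
  have hfinm : IsFiniteMeasure ((volume : Measure (RSpace n)).restrict (tsupport ψ)) :=
    ⟨by simpa using hψc.isCompact.measure_lt_top⟩
  have hYres : MemLp (fun x => (G (φ x)).comp (D x)) (ENNReal.ofReal q)
      (volume.restrict (tsupport ψ)) := hY.mono_measure (Measure.restrict_mono hψs le_rfl)
  have lim2 : Filter.Tendsto
      (fun k => ∫ x in tsupport ψ, ψ x • ((fderiv ℝ (w k) (φ x)).comp (D x)) v) Filter.atTop
      (nhds (∫ x in tsupport ψ, ψ x • ((G (φ x)).comp (D x)) v)) := by
    have := tendsto_integral_clm_apply (μ := volume.restrict (tsupport ψ))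
      (a := fun _ x => ψ x • ContinuousLinearMap.apply ℝ ℝ v)
      (a' := fun x => ψ x • ContinuousLinearMap.apply ℝ ℝ v)
      (X := fun k x => (fderiv ℝ (w k) (φ x)).comp (D x))
      (X' := fun x => (G (φ x)).comp (D x))
      (C := P * ‖(ContinuousLinearMap.apply ℝ ℝ v : (RSpace n →L[ℝ] ℝ) →L[ℝ] ℝ)‖)
      (fun _ => (hψ.continuous.smul continuous_const).aestronglyMeasurable)
      (fun _ x => by rw [norm_smul]; gcongr; exact hP x)
      (Filter.Eventually.of_forall fun x => tendsto_const_nhds)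
      (fun k => (hcompm (hwdm k)).mono_measure (Measure.restrict_mono hψs le_rfl))
      (hYres.integrable hq1) ?_
    · simpa using this
    · set V := ((volume : Measure (RSpace n)).restrict (tsupport ψ)) Set.univ ^
        (1 / (1 : ℝ≥0∞).toReal - 1 / (ENNReal.ofReal q).toReal) with hV
      have hVt : V ≠ ⊤ := ENNReal.rpow_ne_top_of_nonneg (by
        rw [ENNReal.toReal_one, ENNReal.toReal_ofReal (by linarith), sub_nonneg]
        exact one_div_le_one_div_of_le one_pos hq) (measure_ne_top _ _)
      have hz : Filter.Tendsto (fun k : ℕ => K * ENNReal.ofReal (1 / ((k : ℝ) + 1)) * V)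
          Filter.atTop (nhds 0) := by
        have := ENNReal.Tendsto.mul_const (b := V) (ENNReal.Tendsto.const_mul (a := K)
          (ENNReal.tendsto_ofReal hlim) (Or.inr hK.ne)) (Or.inr hVt)
        simpa using this
      refine tendsto_of_tendsto_of_tendsto_of_le_of_le tendsto_const_nhds hz
        (fun _ => zero_le) fun k => ?_
      have e : ((fun x => (fderiv ℝ (w k) (φ x)).comp (D x)) - fun x => (G (φ x)).comp (D x))
          = fun x => ((fderiv ℝ (w k) - G) (φ x)).comp (D x) := by
        ext1 x; simp [ContinuousLinearMap.sub_comp]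
      simp only [e]
      refine (eLpNorm_le_eLpNorm_mul_rpow_measure_univ hq1
        ((hcompm ((hwdm k).sub hGm)).mono_measure (Measure.restrict_mono hψs le_rfl))).trans ?_
      gcongr
      refine (eLpNorm_mono_measure _ (Measure.restrict_mono hψs le_rfl)).trans ?_
      refine (eLpNorm_comp_clm_le hq hnq hqp hΩ hφ hinj h hL hfin ((hwdm k).sub hGm)).trans ?_
      gcongr
      exact hwG k
  have heq : ∀ k, ∫ x in Ω, (fderiv ℝ ψ x v) • (w k ∘ φ) x
      = -∫ x in tsupport ψ, ψ x • ((fderiv ℝ (w k) (φ x)).comp (D x)) v := fun k => by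
    rw [(h.comp_contDiff hΩ hφ (hw k) (hwc k)).2.2 ψ hψ hψc hψs v]
    exact congrArg Neg.neg (hres fun x => (fderiv ℝ (w k) (φ x)).comp (D x))
  rw [tendsto_nhds_unique lim1 (lim2.neg.congr fun k => (heq k).symm)]
  exact congrArg Neg.neg (hres fun x => (G (φ x)).comp (D x)).symm

end Composition

/-! ### Seminorms and the set function `Φ` -/

section Seminorms

variable {n : ℕ}

theorem IsWeakFDeriv.sobolevSeminorm_eq {p : ℝ} {Ω : Set (RSpace n)} (hΩ : IsOpen Ω)
    {f : RSpace n → ℝ} {D : RSpace n → RSpace n →L[ℝ] ℝ} (h : IsWeakFDeriv Ω f D) :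
    sobolevSeminorm p Ω f = eLpNorm D (ENNReal.ofReal p) (volume.restrict Ω) :=
  le_antisymm (iInf₂_le _ h) (le_iInf₂ fun _ h' => (eLpNorm_congr_ae (h.ae_eq hΩ h')).le)

theorem IsWeakFDeriv.distortionNorm_eq {p q : ℝ} {Ω : Set (RSpace n)} (hΩ : IsOpen Ω)
    {φ : RSpace n → RSpace n} {D : RSpace n → RSpace n →L[ℝ] RSpace n} (h : IsWeakFDeriv Ω φ D) :
    distortionNorm p q Ω φ
      = eLpNorm (fun x => pDilatation p (D x)) (kappa p q) (volume.restrict Ω) := by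
  refine le_antisymm (iInf₂_le _ h) (le_iInf₂ fun D' h' => (eLpNorm_congr_ae ?_).le)
  filter_upwards [h.ae_eq hΩ h'] with x hx
  rw [hx]

theorem exists_isWeakFDeriv_of_sobolevSeminorm_lt_top {p : ℝ} {Ω : Set (RSpace n)}
    {f : RSpace n → ℝ} (h : sobolevSeminorm p Ω f < ⊤) : ∃ D, IsWeakFDeriv Ω f D := by
  by_contra! hn
  exact h.ne (by simp [sobolevSeminorm, hn])

theorem sobolevSeminorm_mono {p : ℝ} {A Ω : Set (RSpace n)} (hA : A ⊆ Ω) (f : RSpace n → ℝ) :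
    sobolevSeminorm p A f ≤ sobolevSeminorm p Ω f :=
  le_iInf₂ fun D h => (iInf₂_le D (h.mono hA)).trans
    (eLpNorm_mono_measure _ (Measure.restrict_mono hA le_rfl))

theorem eLpNorm_smul_le_eLpNorm_restrict {G : Type*} [NormedAddCommGroup G] [NormedSpace ℝ G]
    {A : Set (RSpace n)} {η : RSpace n → ℝ} (hs : Function.support η ⊆ A)
    (hη : ∀ x, η x ∈ Set.Icc 0 1) (p : ℝ≥0∞) (D : RSpace n → G) :
    eLpNorm (fun x => η x • D x) p volume ≤ eLpNorm D p (volume.restrict A) := by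
  have hsub : Function.support (fun x => η x • D x) ⊆ A := fun x hx => by
    refine hs fun h0 => hx ?_
    simp [h0]
  rw [← eLpNorm_restrict_eq_of_support_subset hsub]
  refine eLpNorm_mono fun x => ?_
  rw [norm_smul, Real.norm_of_nonneg (hη x).1]
  exact mul_le_of_le_one_left (norm_nonneg _) (hη x).2

/-- A function with compact support in an open set `A`, extended by zero: its weak derivative may
be cut off without increasing the norm. -/
theorem IsWeakFDeriv.exists_memLp_extension {p : ℝ} {A K : Set (RSpace n)} {f : RSpace n → ℝ}
    {D : RSpace n → RSpace n →L[ℝ] ℝ} (h : IsWeakFDeriv A f D) (hA : IsOpen A)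
    (hK : IsCompact K) (hKA : K ⊆ A) (hf : ∀ x ∈ A, x ∉ K → f x = 0)
    (hfin : sobolevSeminorm p A f < ⊤) :
    ∃ G, IsWeakFDeriv Set.univ (A.indicator f) G ∧ MemLp G (ENNReal.ofReal p) volume ∧
      eLpNorm G (ENNReal.ofReal p) volume ≤ sobolevSeminorm p A f := by
  obtain ⟨η, -, -, hs, hη, hG⟩ := h.exists_cutoff_extension hA hK hKA hf
  have hle : eLpNorm (fun x => η x • D x) (ENNReal.ofReal p) volume ≤ sobolevSeminorm p A f := by
    rw [h.sobolevSeminorm_eq hA]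
    exact eLpNorm_smul_le_eLpNorm_restrict ((subset_tsupport η).trans hs) hη _ D
  exact ⟨_, hG, ⟨(locallyIntegrableOn_univ.1 hG.2.1).aestronglyMeasurable, hle.trans_lt hfin⟩, hle⟩

/-- The analytic data of a weakly `(p, q)`-quasiconformal homeomorphism with weak derivative `D`. -/
structure QuasiconformalData (p q : ℝ) (Ω : Set (RSpace n)) (φ : RSpace n → RSpace n)
    (D : RSpace n → RSpace n →L[ℝ] RSpace n) : Prop where
  one_le : 1 ≤ q
  lt : n < q
  le : q ≤ p
  isOpen : IsOpen Ω
  continuousOn : ContinuousOn φ Ω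
  injOn : Set.InjOn φ Ω
  weak : IsWeakFDeriv Ω φ D
  memLp : ∀ K ⊆ Ω, IsCompact K → MemLp φ (ENNReal.ofReal q) (volume.restrict K) ∧
      MemLp D (ENNReal.ofReal q) (volume.restrict K)
  finite_distortion : ∀ᵐ x ∂(volume.restrict Ω), (D x).det = 0 → D x = 0
  norm_lt_top : eLpNorm (fun x => pDilatation p (D x)) (kappa p q) (volume.restrict Ω) < ⊤

variable {p q : ℝ} {Ω Ω' A : Set (RSpace n)} {φ : RSpace n → RSpace n}
  {D : RSpace n → RSpace n →L[ℝ] RSpace n}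

/-- The composition operator `f ↦ f ∘ φ` is bounded from `L¹_p` to `L¹_q`. -/
theorem QuasiconformalData.sobolevSeminorm_comp_le (h : QuasiconformalData p q Ω φ D)
    (hA : IsOpen A) {f : RSpace n → ℝ} (hf : Continuous f) (hfc : HasCompactSupport f)
    (hfA : tsupport f ⊆ A) (hfin : sobolevSeminorm p A f < ⊤) :
    sobolevSeminorm q Ω (f ∘ φ) ≤ distortionNorm p q Ω φ * sobolevSeminorm p A f := by
  obtain ⟨D₀, hD₀⟩ := exists_isWeakFDeriv_of_sobolevSeminorm_lt_top hfin
  obtain ⟨G, hG, hGL, hGle⟩ := hD₀.exists_memLp_extension hA hfc hfA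
    (fun x _ hx => image_eq_zero_of_notMem_tsupport hx) hfin
  have hind : A.indicator f = f := Set.indicator_eq_self.2 ((subset_tsupport f).trans hfA)
  rw [hind] at hG
  have hGm := hGL.1.stronglyMeasurable_mk
  have hcomp := h.weak.comp_of_memLp h.one_le h.lt h.le h.isOpen h.continuousOn h.injOn h.memLp
    h.finite_distortion h.norm_lt_top hf hfc hG hGm hGL.1.ae_eq_mk
    ((memLp_congr_ae hGL.1.ae_eq_mk).1 hGL)
  rw [hcomp.sobolevSeminorm_eq h.isOpen, h.weak.distortionNorm_eq h.isOpen]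
  refine (eLpNorm_comp_clm_le h.one_le h.lt h.le h.isOpen h.continuousOn h.injOn h.weak h.memLp
    h.finite_distortion hGm).trans ?_
  gcongr
  rwa [← eLpNorm_congr_ae hGL.1.ae_eq_mk]

theorem QuasiconformalData.q_pos (h : QuasiconformalData p q Ω φ D) : 0 < q :=
  one_pos.trans_le h.one_le

theorem QuasiconformalData.distortionNorm_lt_top (h : QuasiconformalData p q Ω φ D) :
    distortionNorm p q Ω φ < ⊤ := by
  rw [h.weak.distortionNorm_eq h.isOpen]; exact h.norm_lt_top

/-- The finiteness of `Φ`, with the distortion norm as a bound that does not depend on `A`. -/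
theorem QuasiconformalData.phiFactor_le (h : QuasiconformalData p q Ω φ D)
    (hA : IsOpen A) (hAΩ : A ⊆ Ω') : PhiFactor p q Ω Ω' φ A ≤ distortionNorm p q Ω φ := by
  unfold PhiFactor
  split_ifs with hpq
  · rw [hpq]
  · have hlt : 0 < p - q := sub_pos.2 (lt_of_le_of_ne h.le (Ne.symm hpq))
    have hp : 0 < p := h.q_pos.trans_le h.le
    have he : 0 < p * q / (p - q) := div_pos (mul_pos hp h.q_pos) hlt
    rw [← inv_div, ENNReal.rpow_inv_le_iff he]
    refine iSup₂_le fun f hf => ?_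
    gcongr
    refine ENNReal.div_le_of_le_mul (h.sobolevSeminorm_comp_le hA hf.1 hf.2.1 hf.2.2.1 ?_)
    exact (sobolevSeminorm_mono hAΩ f).trans_lt hf.2.2.2

theorem QuasiconformalData.sobolevSeminorm_comp_le_phiFactor_mul
    (h : QuasiconformalData p q Ω φ D) (hA : IsOpen A) (hAΩ : A ⊆ Ω') {f : RSpace n → ℝ}
    (hf : Continuous f) (hfc : HasCompactSupport f) (hfA : tsupport f ⊆ A)
    (hfin : sobolevSeminorm p Ω' f < ⊤) :
    sobolevSeminorm q Ω (f ∘ φ) ≤ PhiFactor p q Ω Ω' φ A * sobolevSeminorm p A f := by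
  have hfinA := (sobolevSeminorm_mono hAΩ f).trans_lt hfin
  have hle := h.sobolevSeminorm_comp_le hA hf hfc hfA hfinA
  unfold PhiFactor
  split_ifs with hpq
  · subst hpq; exact hle
  · have hlt : 0 < p - q := sub_pos.2 (lt_of_le_of_ne h.le (Ne.symm hpq))
    have hp : 0 < p := h.q_pos.trans_le h.le
    have he : 0 < p * q / (p - q) := div_pos (mul_pos hp h.q_pos) hlt
    have hquot : sobolevSeminorm q Ω (f ∘ φ) / sobolevSeminorm p A f
        ≤ PhiSet p q Ω Ω' φ A ^ ((p - q) / (p * q)) := by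
      rw [← inv_div (p * q), ENNReal.le_rpow_inv_iff he]
      exact le_iSup₂_of_le (f := fun (f : RSpace n → ℝ) (_ : Continuous f ∧ HasCompactSupport f ∧
        tsupport f ⊆ A ∧ sobolevSeminorm p Ω' f < ⊤) =>
        (sobolevSeminorm q Ω (f ∘ φ) / sobolevSeminorm p A f) ^ (p * q / (p - q)))
        f ⟨hf, hfc, hfA, hfin⟩ le_rfl
    -- if the denominator vanishes, so does the numerator, and the quotient says nothing
    rcases eq_or_ne (sobolevSeminorm p A f) 0 with h0 | h0
    · rw [h0, mul_zero] at hle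
      exact hle.trans zero_le
    · exact (ENNReal.div_le_iff h0 hfinA.ne).1 hquot

end Seminorms

/-! ### The metric distortion inequality -/

section Distortion

variable {n : ℕ} {p q : ℝ} {Ω Ω' : Set (RSpace n)}

/-- Morrey's inequality for functions with compact support in `Ω`. -/
theorem enorm_sub_le_sobolevSeminorm (hq : 1 ≤ q) (hnq : n < q) (hΩ : IsOpen Ω)
    {g : RSpace n → ℝ} (hg : ContinuousOn g Ω) {K : Set (RSpace n)} (hK : IsCompact K)
    (hKΩ : K ⊆ Ω) (hgK : ∀ x ∈ Ω, x ∉ K → g x = 0) (hfin : sobolevSeminorm q Ω g < ⊤)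
    {x y : RSpace n} (hx : x ∈ Ω) (hy : y ∈ Ω) (hxy : x ≠ y) :
    ‖g x - g y‖ₑ ≤ ENNReal.ofReal (4 * dist x y) * (morreyConst n q *
      ((volume (Metric.closedBall x (dist x y)))⁻¹ ^ (1 / q) * sobolevSeminorm q Ω g)) := by
  obtain ⟨D₀, hD₀⟩ := exists_isWeakFDeriv_of_sobolevSeminorm_lt_top hfin
  obtain ⟨G, hG, hGL, hGle⟩ := hD₀.exists_memLp_extension hΩ hK hKΩ hgK hfin
  have hsupp : Function.support (Ω.indicator g) ⊆ K := fun z hz => by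
    by_contra hzK
    refine hz ?_
    by_cases hzΩ : z ∈ Ω
    · rw [Set.indicator_of_mem hzΩ, hgK z hzΩ hzK]
    · exact Set.indicator_of_notMem hzΩ _
  have htsupp : tsupport (Ω.indicator g) ⊆ K := closure_minimal hsupp hK.isClosed
  have hcont : Continuous (Ω.indicator g) := continuous_of_tsupport fun z hz => by
    have hzΩ := hΩ.mem_nhds (hKΩ (htsupp hz))
    exact (hg.continuousAt hzΩ).congr
      (Filter.eventually_of_mem hzΩ fun w hw => (Set.indicator_of_mem hw g).symm)
  have hM := hG.enorm_sub_le_morrey hcont (hK.of_isClosed_subset (isClosed_tsupport _) htsupp)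
    hq hnq hGL 0 (c := x) (x := x) (y := y) (dist_pos.2 hxy)
    (Metric.mem_closedBall_self dist_nonneg) (by rw [Metric.mem_closedBall, dist_comm])
  simp only [zero_apply, sub_zero] at hM
  rw [Set.indicator_of_mem hx, Set.indicator_of_mem hy,
    lintegral_cond_rpow_eq_eLpNorm _ (by linarith)] at hM
  refine hM.trans ?_
  gcongr
  exact (eLpNorm_mono_measure _ Measure.restrict_le_self).trans hGle

theorem ball_subset_of_lt_infEDist_frontier (hΩ : IsOpen Ω') {y : RSpace n} (hy : y ∈ Ω') {r : ℝ}
    (hr : 0 < r) (h : ENNReal.ofReal r < Metric.infEDist y (frontier Ω')) :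
    Metric.ball y r ⊆ Ω' := by
  refine (convex_ball y r).isPreconnected.subset_of_closure_inter_subset hΩ
    ⟨y, Metric.mem_ball_self hr, hy⟩ ?_
  rintro z ⟨hz, hzr⟩
  by_contra hn
  have hfr : z ∈ frontier Ω' := by rw [hΩ.frontier_eq]; exact ⟨hz, hn⟩
  have h1 := (Metric.infEDist_le_edist_of_mem (x := y) hfr).trans_lt
    ((edist_lt_ofReal).2 (Metric.mem_ball'.1 hzr))
  exact lt_asymm h h1

/-- A smooth function that is `1` at the centre of a ball, vanishes outside the ball of half the
radius, and has the natural bound for its gradient. The constant depends on the dimension only. -/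
theorem exists_bump_sobolevSeminorm_le (n : ℕ) :
    ∃ M : ℝ, 0 ≤ M ∧ ∀ p : ℝ, ∀ y : RSpace n, ∀ r : ℝ, 0 < r → ∃ f : RSpace n → ℝ,
      Continuous f ∧ HasCompactSupport f ∧ tsupport f ⊆ Metric.ball y r ∧ f y = 1 ∧
      (∀ z, r ≤ dist y z → f z = 0) ∧ (∀ Ω', sobolevSeminorm p Ω' f < ⊤) ∧
      sobolevSeminorm p (Metric.ball y r) f ≤
        volume (Metric.ball y r) ^ (ENNReal.ofReal p).toReal⁻¹ * ENNReal.ofReal (M / r) := by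
  let χ : ContDiffBump (0 : RSpace n) := ⟨1 / 4, 1 / 2, by norm_num, by norm_num⟩
  have hχ : ContDiff ℝ 1 χ := χ.contDiff
  obtain ⟨M, hM⟩ := (hχ.continuous_fderiv one_ne_zero).bounded_above_of_compact_support
    (χ.hasCompactSupport.fderiv ℝ)
  refine ⟨M, (norm_nonneg _).trans (hM 0), fun p y r hr => ?_⟩
  set f : RSpace n → ℝ := fun z => χ (r⁻¹ • (z - y)) with hf
  have hd : ContDiff ℝ 1 f := hχ.comp (by fun_prop)
  have hzero : ∀ z, r / 2 ≤ dist y z → f z = 0 := fun z hz => by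
    refine χ.zero_of_le_dist ?_
    rw [dist_zero_right, norm_smul, norm_inv, Real.norm_of_nonneg hr.le, ← dist_eq_norm,
      dist_comm, inv_mul_eq_div, le_div_iff₀ hr]
    change 1 / 2 * r ≤ dist y z
    linarith
  have hts : tsupport f ⊆ Metric.closedBall y (r / 2) := by
    refine closure_minimal (fun z hz => ?_) Metric.isClosed_closedBall
    by_contra hn
    exact hz (hzero z (by rw [Metric.mem_closedBall, dist_comm] at hn; linarith))
  have hfc : HasCompactSupport f :=
    (isCompact_closedBall y (r / 2)).of_isClosed_subset (isClosed_tsupport _) hts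
  have hbound : ∀ z, ‖fderiv ℝ f z‖ ≤ M / r := fun z => by
    have h1 : HasFDerivAt (fun z : RSpace n => r⁻¹ • (z - y))
        (r⁻¹ • ContinuousLinearMap.id ℝ (RSpace n)) z :=
      ((hasFDerivAt_id z).sub_const y).const_smul r⁻¹
    have h2 := (hχ.differentiable one_ne_zero (r⁻¹ • (z - y))).hasFDerivAt.comp z h1
    have h3 : fderiv ℝ f z = r⁻¹ • fderiv ℝ χ (r⁻¹ • (z - y)) := by
      refine (h2.fderiv).trans ?_
      ext v; simp
    rw [h3, norm_smul, norm_inv, Real.norm_of_nonneg hr.le, inv_mul_eq_div]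
    gcongr
    exact hM _
  refine ⟨f, hd.continuous, hfc,
    hts.trans (Metric.closedBall_subset_ball (by linarith)), ?_, fun z hz => hzero z (by linarith),
    fun Ω' => ?_, ?_⟩
  · simp only [hf, sub_self, smul_zero]
    exact χ.one_of_mem_closedBall (Metric.mem_closedBall_self χ.rIn_pos.le)
  · refine (iInf₂_le _ (hd.isWeakFDeriv Ω')).trans_lt ?_
    exact ((hd.continuous_fderiv one_ne_zero).memLp_of_hasCompactSupport
      (hfc.fderiv ℝ)).restrict Ω' |>.2
  · refine (iInf₂_le _ (hd.isWeakFDeriv _)).trans ?_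
    refine (eLpNorm_le_of_ae_bound (Filter.Eventually.of_forall hbound)).trans (le_of_eq ?_)
    rw [Measure.restrict_apply_univ]

/-- The metric distortion inequality. A bump function `f` on the ball around `y₁` through `y₂`
differs by `1` at these points; Morrey's inequality for `f ∘ φ` bounds that difference. -/
theorem exists_metric_distortion_const (hn : 1 ≤ n) (hnq : (n : ℝ) < q) (hqp : q ≤ p) :
    ∃ c : ℝ, 0 < c ∧ ∀ (Ω Ω' : Set (RSpace n)) (φ : OpenPartialHomeomorph (RSpace n) (RSpace n))
      (D : RSpace n → RSpace n →L[ℝ] RSpace n), IsOpen Ω' → φ.source = Ω → φ.target = Ω' →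
      QuasiconformalData p q Ω φ D → ∀ y₁ ∈ Ω', ∀ y₂ ∈ Ω', ∀ r : ℝ, dist y₁ y₂ = r →
      Metric.ball y₁ r ⊆ Ω' →
      dist y₁ y₂ ^ ((p - n) / p) ≤ c * (PhiFactor p q Ω Ω' φ (Metric.ball y₁ r)).toReal *
        dist (φ.symm y₁) (φ.symm y₂) ^ ((q - n) / q) := by
  have hn' : (1 : ℝ) ≤ n := by exact_mod_cast hn
  have hq0 : 0 < q := by linarith
  have hp0 : 0 < p := hq0.trans_le hqp
  obtain ⟨M, hM0, hbump⟩ := exists_bump_sobolevSeminorm_le n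
  set V := volume (Metric.ball (0 : RSpace n) 1) with hV
  have hVt : V ≠ ⊤ := measure_ball_lt_top.ne
  have hV0 : 0 < V.toReal :=
    ENNReal.toReal_pos (Metric.measure_ball_pos _ _ one_pos).ne' hVt
  set C := (morreyConst n q).toReal with hC
  have hC0 : 0 ≤ C := ENNReal.toReal_nonneg
  set c₀ := 4 * C * (V.toReal⁻¹ ^ (1 / q)) * (V.toReal ^ p⁻¹) * M with hc₀
  have hc₀0 : 0 ≤ c₀ := by positivity
  refine ⟨c₀ + 1, by positivity, fun Ω Ω' φ D hΩ' hs ht h y₁ hy₁ y₂ hy₂ r hr hball => ?_⟩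
  rcases eq_or_ne y₁ y₂ with rfl | hne
  · rw [dist_self, Real.zero_rpow (div_pos (by linarith) hp0).ne']
    positivity
  have hr0 : 0 < r := hr ▸ dist_pos.2 hne
  set x₁ := φ.symm y₁ with hx₁def
  set x₂ := φ.symm y₂ with hx₂def
  have hx₁ : x₁ ∈ Ω := hs ▸ φ.map_target (ht.symm ▸ hy₁)
  have hx₂ : x₂ ∈ Ω := hs ▸ φ.map_target (ht.symm ▸ hy₂)
  have hφ₁ : φ x₁ = y₁ := φ.right_inv (ht.symm ▸ hy₁)
  have hφ₂ : φ x₂ = y₂ := φ.right_inv (ht.symm ▸ hy₂)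
  have hxne : x₁ ≠ x₂ := fun he => hne (by rw [← hφ₁, ← hφ₂, he])
  set d := dist x₁ x₂ with hd
  have hd0 : 0 < d := dist_pos.2 hxne
  obtain ⟨f, hfcont, hfc, hfball, hf1, hf0, hfin, hfle⟩ := hbump p y₁ r hr0
  set Φ := PhiFactor p q Ω Ω' φ (Metric.ball y₁ r) with hΦ
  have hΦt : Φ < ⊤ := (h.phiFactor_le Metric.isOpen_ball hball).trans_lt h.distortionNorm_lt_top
  have hcomp := h.sobolevSeminorm_comp_le_phiFactor_mul Metric.isOpen_ball hball hfcont hfc hfball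
    (hfin Ω')
  have hS := hcomp.trans (mul_le_mul' le_rfl hfle)
  rw [Measure.addHaar_ball_of_pos volume y₁ hr0, ENNReal.toReal_ofReal hp0.le,
    finrank_euclideanSpace_fin, ← hV] at hS
  have hfinq : sobolevSeminorm q Ω (f ∘ φ) < ⊤ :=
    hcomp.trans_lt (ENNReal.mul_lt_top hΦt (hfin _))
  -- `f ∘ φ` is supported in the preimage of the support of `f`
  have hK : IsCompact (φ.symm '' tsupport f) := hfc.isCompact.image_of_continuousOn
    (φ.continuousOn_symm.mono (ht ▸ hfball.trans hball))
  have hKΩ : φ.symm '' tsupport f ⊆ Ω := by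
    rintro _ ⟨y, hy, rfl⟩
    exact hs ▸ φ.map_target (ht.symm ▸ hball (hfball hy))
  have hfK : ∀ x ∈ Ω, x ∉ φ.symm '' tsupport f → (f ∘ φ) x = 0 := fun x hx hxK => by
    refine image_eq_zero_of_notMem_tsupport (f := f) fun hmem => hxK ⟨φ x, hmem, ?_⟩
    exact φ.left_inv (hs.symm ▸ hx)
  have hmor := enorm_sub_le_sobolevSeminorm h.one_le h.lt h.isOpen
    (hfcont.comp_continuousOn h.continuousOn) hK hKΩ hfK hfinq hx₁ hx₂ hxne
  have hone : ‖(f ∘ φ) x₁ - (f ∘ φ) x₂‖ₑ = 1 := by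
    simp only [Function.comp_apply, hφ₁, hφ₂, hf1, hf0 y₂ hr.ge]
    simp
  rw [hone, Measure.addHaar_closedBall volume x₁ hd0.le, finrank_euclideanSpace_fin, ← hV] at hmor
  have hall := hmor.trans (mul_le_mul' le_rfl (mul_le_mul' le_rfl (mul_le_mul' le_rfl hS)))
  -- pass to real numbers; all factors are finite
  have e1 : (ENNReal.ofReal (d ^ n) * V)⁻¹ ^ (1 / q)
      = ENNReal.ofReal ((d ^ n * V.toReal)⁻¹ ^ (1 / q)) := by
    rw [← ENNReal.ofReal_toReal hVt, ENNReal.toReal_ofReal hV0.le,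
      ← ENNReal.ofReal_mul (by positivity), ← ENNReal.ofReal_inv_of_pos (by positivity),
      ENNReal.ofReal_rpow_of_pos (by positivity)]
  have e2 : (ENNReal.ofReal (r ^ n) * V) ^ p⁻¹
      = ENNReal.ofReal ((r ^ n * V.toReal) ^ p⁻¹) := by
    rw [← ENNReal.ofReal_toReal hVt, ENNReal.toReal_ofReal hV0.le,
      ← ENNReal.ofReal_mul (by positivity), ENNReal.ofReal_rpow_of_pos (by positivity)]
  rw [← hd, ← hΦ, e1, e2, ← ENNReal.ofReal_toReal hΦt.ne,
    ← ENNReal.ofReal_toReal (morreyConst_lt_top hnq).ne,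
    ← ENNReal.ofReal_mul (by positivity), ← ENNReal.ofReal_mul (by positivity),
    ← ENNReal.ofReal_mul (by positivity), ← ENNReal.ofReal_mul (by positivity),
    ← ENNReal.ofReal_mul (by positivity), ENNReal.one_le_ofReal, ← hC] at hall
  have e3 : (d ^ n * V.toReal)⁻¹ ^ (1 / q) = V.toReal⁻¹ ^ (1 / q) * (d ^ ((q - n) / q) / d) := by
    rw [mul_inv, Real.mul_rpow (by positivity) (by positivity), mul_comm]
    congr 1
    rw [← Real.rpow_natCast, ← Real.rpow_neg hd0.le, ← Real.rpow_mul hd0.le,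
      ← Real.rpow_sub_one hd0.ne']
    congr 1; field_simp; ring
  have e4 : (r ^ n * V.toReal) ^ p⁻¹ = V.toReal ^ p⁻¹ * (r / r ^ ((p - n) / p)) := by
    rw [Real.mul_rpow (by positivity) (by positivity), mul_comm]
    congr 1
    rw [← Real.rpow_natCast, ← Real.rpow_mul hr0.le, eq_div_iff (by positivity),
      ← Real.rpow_add hr0]
    conv_rhs => rw [← Real.rpow_one r]
    congr 1; field_simp; ring
  rw [e3, e4] at hall
  have hrp : 0 < r ^ ((p - n) / p) := by positivity
  have hfinal : r ^ ((p - n) / p) ≤ c₀ * Φ.toReal * d ^ ((q - n) / q) := by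
    have := mul_le_mul_of_nonneg_right hall hrp.le
    rw [one_mul] at this
    refine this.trans (le_of_eq ?_)
    rw [hc₀]
    field_simp
  rw [hr]
  refine hfinal.trans ?_
  gcongr
  linarith

end Distortion

/-! ### Hölder continuity -/

section Hoelder

variable {n : ℕ}

/-- A continuous map that is Hölder continuous at small scales near a compact set is Hölder
continuous on that set. -/
theorem exists_hoelder_const_of_isCompact {φ : RSpace n → RSpace n} {F Ω' : Set (RSpace n)}
    (hF : IsCompact F) (hφ : ContinuousOn φ F) (hΩ' : IsOpen Ω') (hFΩ : φ '' F ⊆ Ω')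
    {γ C : ℝ} (hγ : 0 ≤ γ)
    (h : ∀ x₁ ∈ F, ∀ x₂ ∈ F, edist (φ x₁) (φ x₂) < Metric.infEDist (φ x₁) (frontier Ω') →
      dist (φ x₁) (φ x₂) ≤ C * dist x₁ x₂ ^ γ) :
    ∃ C' : ℝ, ∀ x₁ ∈ F, ∀ x₂ ∈ F, dist (φ x₁) (φ x₂) ≤ C' * dist x₁ x₂ ^ γ := by
  have hcomp : IsCompact (φ '' F) := hF.image_of_continuousOn hφ
  obtain ⟨δ, hδ, hδΩ⟩ := hcomp.exists_cthickening_subset_open hΩ' hFΩ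
  obtain ⟨ε, hε, hεδ⟩ := Metric.uniformContinuousOn_iff.1
    (hF.uniformContinuousOn_of_continuous hφ) δ hδ
  set d := Metric.diam (φ '' F)
  refine ⟨max C (d / ε ^ γ), fun x₁ h₁ x₂ h₂ => ?_⟩
  have hnn : 0 ≤ dist x₁ x₂ ^ γ := Real.rpow_nonneg dist_nonneg _
  rcases lt_or_ge (dist (φ x₁) (φ x₂)) δ with hlt | hge
  · refine (h x₁ h₁ x₂ h₂ ?_).trans (mul_le_mul_of_nonneg_right (le_max_left _ _) hnn)
    refine (edist_lt_ofReal.2 hlt).trans_le (Metric.le_infEDist.2 fun z hz => ?_)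
    by_contra! hn
    have hzΩ : z ∈ Ω' := hδΩ (Metric.mem_cthickening_of_dist_le z (φ x₁) δ _ ⟨x₁, h₁, rfl⟩
      (by rw [dist_comm]; exact (edist_lt_ofReal.1 hn).le))
    rw [hΩ'.frontier_eq] at hz
    exact hz.2 hzΩ
  · have hfar : ε ≤ dist x₁ x₂ := by
      by_contra! hn
      exact absurd (hεδ x₁ h₁ x₂ h₂ hn) (not_lt.2 hge)
    have hεγ : 0 < ε ^ γ := Real.rpow_pos_of_pos hε _
    calc dist (φ x₁) (φ x₂) ≤ d :=
          Metric.dist_le_diam_of_mem hcomp.isBounded ⟨x₁, h₁, rfl⟩ ⟨x₂, h₂, rfl⟩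
      _ = d / ε ^ γ * ε ^ γ := by field_simp
      _ ≤ d / ε ^ γ * dist x₁ x₂ ^ γ :=
          mul_le_mul_of_nonneg_left (Real.rpow_le_rpow hε.le hfar hγ)
            (div_nonneg Metric.diam_nonneg hεγ.le)
      _ ≤ _ := mul_le_mul_of_nonneg_right (le_max_right _ _) hnn

end Hoelder

theorem mainTheorem11 (n : ℕ) (hn : 1 ≤ n) (p q : ℝ) (hnq : (n : ℝ) < q) (hqp : q ≤ p) :
    ∃ c : ℝ, 0 < c ∧
      ∀ (Ω Ω' : Set (RSpace n)) (φ : OpenPartialHomeomorph (RSpace n) (RSpace n)),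
        IsOpen Ω → IsConnected Ω → IsOpen Ω' → IsConnected Ω' →
        φ.source = Ω → φ.target = Ω' →
        IsWeakQuasiconformal p q Ω φ →
        -- the metric distortion inequality, with a finite factor
        (∀ y₁ ∈ Ω', ∀ y₂ ∈ Ω', ∀ r : ℝ, dist y₁ y₂ = r →
          ENNReal.ofReal r < Metric.infEDist y₁ (frontier Ω') →
          PhiFactor p q Ω Ω' φ (Metric.ball y₁ r) < ⊤ ∧
          dist y₁ y₂ ^ ((p - n) / p) ≤
            c * (PhiFactor p q Ω Ω' φ (Metric.ball y₁ r)).toReal *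
              dist (φ.symm y₁) (φ.symm y₂) ^ ((q - n) / q)) ∧
        -- Hölder continuity: the exponent, a uniform constant at the scale of the inequality,
        -- and membership in the Hölder class on compact subsets
        (0 < (q - n) * p / ((p - n) * q) ∧ (q - n) * p / ((p - n) * q) ≤ 1) ∧
        (∃ C : ℝ, ∀ x₁ ∈ Ω, ∀ x₂ ∈ Ω,
          edist (φ x₁) (φ x₂) < Metric.infEDist (φ x₁) (frontier Ω') →
          dist (φ x₁) (φ x₂) ≤ C * dist x₁ x₂ ^ ((q - n) * p / ((p - n) * q))) ∧
        (∀ F : Set (RSpace n), F ⊆ Ω → IsCompact F →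
          ∃ C : ℝ, ∀ x₁ ∈ F, ∀ x₂ ∈ F,
            dist (φ x₁) (φ x₂) ≤ C * dist x₁ x₂ ^ ((q - n) * p / ((p - n) * q))) := by
  obtain ⟨c, hc, hmetric⟩ := exists_metric_distortion_const (p := p) hn hnq hqp
  refine ⟨c, hc, fun Ω Ω' φ hΩ _ hΩ' _ hs ht hφ => ?_⟩
  obtain ⟨D, hD, hL, hfin, hK⟩ := hφ
  have hn1 : (1 : ℝ) ≤ n := by exact_mod_cast hn
  have hq0 : 0 < q := by linarith
  have hp0 : 0 < p := by linarith
  have hqn : 0 < q - n := sub_pos.2 hnq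
  have hpn : 0 < p - n := by linarith
  have h : QuasiconformalData p q Ω φ D :=
    ⟨by linarith, hnq, hqp, hΩ, hs ▸ φ.continuousOn, hs ▸ φ.injOn, hD, hL, hfin, hK⟩
  have hball : ∀ y₁ ∈ Ω', ∀ y₂ ∈ Ω', ∀ r : ℝ, dist y₁ y₂ = r →
      ENNReal.ofReal r < Metric.infEDist y₁ (frontier Ω') → Metric.ball y₁ r ⊆ Ω' := by
    intro y₁ hy₁ y₂ _ r hr hlt
    rcases (hr ▸ dist_nonneg : 0 ≤ r).eq_or_lt with rfl | hr0
    · simp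
    · exact ball_subset_of_lt_infEDist_frontier hΩ' hy₁ hr0 hlt
  have hexp : 0 < (q - n) * p / ((p - n) * q) := by positivity
  set κ := (distortionNorm p q Ω φ).toReal with hκ
  have hκ0 : 0 ≤ κ := ENNReal.toReal_nonneg
  have hhoelder : ∀ x₁ ∈ Ω, ∀ x₂ ∈ Ω,
      edist (φ x₁) (φ x₂) < Metric.infEDist (φ x₁) (frontier Ω') →
      dist (φ x₁) (φ x₂) ≤
        (c * κ) ^ (p / (p - n)) * dist x₁ x₂ ^ ((q - n) * p / ((p - n) * q)) := by
    intro x₁ hx₁ x₂ hx₂ hlt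
    have hy₁ : φ x₁ ∈ Ω' := ht ▸ φ.map_source (hs.symm ▸ hx₁)
    have hy₂ : φ x₂ ∈ Ω' := ht ▸ φ.map_source (hs.symm ▸ hx₂)
    rw [edist_dist] at hlt
    have hsub := hball _ hy₁ _ hy₂ _ rfl hlt
    have hm := hmetric Ω Ω' φ D hΩ' hs ht h _ hy₁ _ hy₂ _ rfl hsub
    rw [φ.left_inv (hs.symm ▸ hx₁), φ.left_inv (hs.symm ▸ hx₂)] at hm
    have hle : (PhiFactor p q Ω Ω' φ (Metric.ball (φ x₁) (dist (φ x₁) (φ x₂)))).toReal ≤ κ :=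
      ENNReal.toReal_mono h.distortionNorm_lt_top.ne (h.phiFactor_le Metric.isOpen_ball hsub)
    have hm2 : dist (φ x₁) (φ x₂) ^ ((p - n) / p) ≤ c * κ * dist x₁ x₂ ^ ((q - n) / q) :=
      hm.trans (by gcongr)
    calc dist (φ x₁) (φ x₂) = (dist (φ x₁) (φ x₂) ^ ((p - n) / p)) ^ (p / (p - n)) := by
          rw [← Real.rpow_mul dist_nonneg, div_mul_div_cancel₀ hp0.ne', div_self hpn.ne',
            Real.rpow_one]
      _ ≤ (c * κ * dist x₁ x₂ ^ ((q - n) / q)) ^ (p / (p - n)) :=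
          Real.rpow_le_rpow (by positivity) hm2 (by positivity)
      _ = _ := by
          rw [Real.mul_rpow (by positivity) (by positivity), ← Real.rpow_mul dist_nonneg]
          congr 2
          field_simp
  refine ⟨fun y₁ hy₁ y₂ hy₂ r hr hlt => ?_, ⟨hexp, ?_⟩, ⟨_, hhoelder⟩, fun F hF hFc => ?_⟩
  · have hsub := hball y₁ hy₁ y₂ hy₂ r hr hlt
    exact ⟨(h.phiFactor_le Metric.isOpen_ball hsub).trans_lt h.distortionNorm_lt_top,
      hmetric Ω Ω' φ D hΩ' hs ht h y₁ hy₁ y₂ hy₂ r hr hsub⟩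
  · rw [div_le_one (by positivity)]
    nlinarith
  · refine exists_hoelder_const_of_isCompact hFc (h.continuousOn.mono hF) hΩ' ?_ hexp.le
      fun x₁ h₁ x₂ h₂ hlt => hhoelder x₁ (hF h₁) x₂ (hF h₂) hlt
    rintro _ ⟨x, hx, rfl⟩
    exact ht ▸ φ.map_source (hs.symm ▸ hF hx)
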